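/- Let $\Theta\subset\mathbb R^d$ be compact and let $(\nu_\theta)_{\theta\in\Theta}$ be probability measures on $(0,1)$. Under $\mathbb P^\theta=\nu_\theta^{\otimes\mathbb Z}$ the environment $\omega=(\omega_x)_{x\in\mathbb Z}$ is i.i.d. with law $\nu_\theta$; given $\omega$, $X=(X_t)_{t\ge 0}$ is the Markov chain on $\mathbb Z$ with $X_0=0$ that jumps from $x$ to $x+1$ with probability $\omega_x$ and to $x-1$ with probability $1-\omega_x$; its law is $P_\omega$. The annealed law is $\mathbf P^\theta(\cdot)=\int P_\omega(\cdot)\,d\mathbb P^\theta(\omega)$. Put $\rho_x=(1-\omega_x)/\omega_x$, $T_n=\inf\{t: X_t=n\}$, $L^n_x=\#\{0\le t<T_n : X_t=x,\ X_{t+1}=x-1\}$ for $0\le x\le n$, and for integers $u,v\ge 0$ $$\phi_\theta(u,v)=\log\int_0^1 a^{u+1}(1-a)^v\,d\nu_\theta(a),\qquad Q_\theta(u,v)=\binom{u+v}{v}\int_0^1 a^{u+1}(1-a)^v\,d\nu_\theta(a),$$ $$S=\Big(\sum_{k\ge 0}\prod_{i=1}^k\rho_i\Big)^{-1},\qquad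 \pi_\theta(u)=\mathbb E^\theta[S(1-S)^u],\qquad \tilde\pi_\theta(u,v)=\pi_\theta(u)\,Q_\theta(u,v).$$ Fix $\theta_0\in\Theta$ and let the true parameter $\theta^\star$ be an interior point of $\Theta$. Assume: 1. for every $\theta\in\Theta$: $\mathbb E^\theta|\log\rho_0|<\infty$, $\mathbb E^\theta\log\rho_0<0$ and $1\le\mathbb E^\theta\rho_0<\infty$; 2. (i) for all integers $u,v\ge 0$, $\theta\mapsto\phi_\theta(u,v)$ is continuous on $\Theta$; (ii) for all $\theta,\theta'\in\Theta$, $\nu_\theta\ne\nu_{\theta'}$ if and only if $\theta\neq\theta'$; (iii) for every $\theta\in\Theta$, $\sum_{u,v\ge 0}\tilde\pi_\theta(u,v)\,\sup_{\theta'\in\Theta}|\phi_{\theta'}(u,v)-\phi_{\theta_0}(u,v)|<\infty$. For each $n$ let $\hat\theta_n$ be any measurable function of $X$ with values in $\Theta$ that ($\mathbf P^{\theta^\star}$-almost surely, whenever $T_n<\infty$) maximizes over $\theta\in\Theta$ the criterion $$\ell^{\mathrm{sb}}_n(\theta)=\sum_{x=0}^{n-1}\big[\phi_\theta(L^n_{x+1},L^n_x)-\phi_{\theta_0}(L^n_{x+1},L^n_x)\big].$$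 Then $\hat\theta_n\to\theta^\star$ in $\mathbf P^{\theta^\star}$-probability as $n\to\infty$. -/

import Mathlib

open MeasureTheory ProbabilityTheory Filter Topology
open scoped ENNReal

noncomputable section

namespace RWRE

/-- An environment: a `(0,1)`-valued family `ω = (ω_x)` indexed by the sites `x ∈ ℤ`. -/
abbrev Env : Type := ℤ → Set.Ioo (0 : ℝ) 1

/-- The law `ν^{⊗ ℤ}` of an i.i.d. environment with marginal `ν`. -/
def envLaw (ν : ProbabilityMeasure (Set.Ioo (0 : ℝ) 1)) : Measure Env :=
  Measure.infinitePi (fun _ : ℤ => (ν : Measure (Set.Ioo (0 : ℝ) 1)))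

/-- The ratio `ρ_x = (1 - ω_x) / ω_x`. -/
def rho (ω : Env) (x : ℤ) : ℝ := (1 - (ω x : ℝ)) / (ω x : ℝ)

/-- One step of the walk from `x` in the environment `ω`: to `x + 1` with probability `ω_x`,
to `x - 1` with probability `1 - ω_x`. -/
def stepLaw (ω : Env) (x : ℤ) : Measure ℤ :=
  ENNReal.ofReal (ω x : ℝ) • Measure.dirac (x + 1) +
    ENNReal.ofReal (1 - (ω x : ℝ)) • Measure.dirac (x - 1)

instance (ω : Env) (x : ℤ) : IsProbabilityMeasure (stepLaw ω x) := by
  constructor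
  have h := (ω x).2
  simp only [stepLaw, Measure.coe_add, Measure.coe_smul, Pi.add_apply, Pi.smul_apply,
    measure_univ, smul_eq_mul, mul_one]
  rw [← ENNReal.ofReal_add h.1.le (by linarith [h.2])]
  simp

/-- The transition kernel of the walk, as a function of the past `(X_0, …, X_n)`: it depends on the
last position only. -/
def stepKernel (ω : Env) (n : ℕ) : Kernel (Finset.Iic n → ℤ) ℤ where
  toFun h := stepLaw ω (h ⟨n, Finset.mem_Iic.2 le_rfl⟩)
  measurable' := (measurable_of_countable (stepLaw ω)).comp (measurable_pi_apply _)

instance (ω : Env) (n : ℕ) : IsMarkovKernel (stepKernel ω n) :=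
  ⟨fun h => inferInstanceAs
    (IsProbabilityMeasure (stepLaw ω (h ⟨n, Finset.mem_Iic.2 le_rfl⟩)))⟩

/-- The quenched law `P_ω` on path space `ℤ^ℕ` (Ionescu-Tulcea): the law of the Markov chain with
transitions `stepLaw ω` started at `X_0 = 0`. -/
def quenchedMeasure (ω : Env) : Measure (ℕ → ℤ) :=
  Kernel.traj (X := fun _ => ℤ) (stepKernel ω) 0 (fun _ => 0)

instance (ω : Env) : IsProbabilityMeasure (quenchedMeasure ω) := by
  unfold quenchedMeasure; infer_instance

theorem partialTraj_singleton (ω : Env) (x : ℕ → ℤ) (n : ℕ) :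
    Kernel.partialTraj (X := fun _ => ℤ) (stepKernel ω) 0 n (fun _ => 0)
        {fun i : Finset.Iic n => x i} =
      (if x 0 = 0 then 1 else 0) * ∏ i ∈ Finset.range n, stepLaw ω (x i) {x (i + 1)} := by
  induction n with
  | zero =>
    rw [Kernel.partialTraj_self, Kernel.id_apply, Measure.dirac_apply' _ (.singleton _)]
    have key : ((fun _ => 0 : Finset.Iic 0 → ℤ) = fun i : Finset.Iic 0 => x i) ↔ x 0 = 0 := by
      refine ⟨fun h => (congrFun h ⟨0, by simp⟩).symm, fun h => ?_⟩
      funext ⟨i, hi⟩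
      have : i = 0 := by simpa using hi
      subst this; exact h.symm
    by_cases h : x 0 = 0 <;> simp [Set.indicator, key, h]
  | succ n ih =>
    rw [Kernel.partialTraj_succ_of_le (Nat.zero_le n),
      Kernel.map_apply' _ (by fun_prop) _ (.singleton _),
      Kernel.comp_apply' _ _ _ ((by fun_prop : Measurable (IicProdIoc (X := fun _ => ℤ) n (n + 1)))
        (.singleton _))]
    have hpt : ∀ y : Finset.Iic n → ℤ,
        (Kernel.id ×ₖ (stepKernel ω n).map (MeasurableEquiv.piSingleton (X := fun _ => ℤ) n)) y
          (IicProdIoc (X := fun _ => ℤ) n (n + 1) ⁻¹' {fun i : Finset.Iic (n + 1) => x i}) =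
        Set.indicator {fun i : Finset.Iic n => x i} (fun _ => stepLaw ω (x n) {x (n + 1)}) y := by
      intro y
      rw [Kernel.id_prod_apply' _ _ ((by fun_prop : Measurable
          (IicProdIoc (X := fun _ => ℤ) n (n + 1))) (.singleton _)),
        Kernel.map_apply' _ (by fun_prop) _ (measurable_prodMk_left
          ((by fun_prop : Measurable (IicProdIoc (X := fun _ => ℤ) n (n + 1))) (.singleton _)))]
      by_cases hy : y = fun i : Finset.Iic n => x i
      · have hs : (MeasurableEquiv.piSingleton (X := fun _ => ℤ) n) ⁻¹'
            (Prod.mk y ⁻¹' (IicProdIoc (X := fun _ => ℤ) n (n + 1) ⁻¹'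
              {fun i : Finset.Iic (n + 1) => x i})) = {x (n + 1)} := by
          ext z
          simp only [Set.mem_preimage, Set.mem_singleton_iff, funext_iff]
          constructor
          · intro h
            have := h ⟨n + 1, by simp⟩
            simpa [IicProdIoc, MeasurableEquiv.piSingleton] using this
          · rintro rfl ⟨i, hi⟩
            by_cases hin : i ≤ n
            · simp [IicProdIoc, hin, hy]
            · have : i = n + 1 := by
                have := Finset.mem_Iic.1 hi
                omega
              subst this
              simp [IicProdIoc, MeasurableEquiv.piSingleton]
        rw [hs, Set.indicator_of_mem (by simpa using hy)]
        simp [stepKernel, hy]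
      · have hs : (MeasurableEquiv.piSingleton (X := fun _ => ℤ) n) ⁻¹'
            (Prod.mk y ⁻¹' (IicProdIoc (X := fun _ => ℤ) n (n + 1) ⁻¹'
              {fun i : Finset.Iic (n + 1) => x i})) = ∅ := by
          ext z
          simp only [Set.mem_preimage, Set.mem_singleton_iff, Set.mem_empty_iff_false, iff_false]
          intro h
          apply hy
          funext ⟨i, hi⟩
          have hi' := Finset.mem_Iic.1 hi
          have := congrFun h ⟨i, Finset.mem_Iic.2 (by omega)⟩
          simpa [IicProdIoc, hi'] using this
        rw [hs, Set.indicator_of_notMem (by simpa using hy)]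
        simp
    simp_rw [hpt]
    rw [lintegral_indicator_const (.singleton _), ih, Finset.prod_range_succ]
    ring

/-- Finite-dimensional distributions of the quenched law. -/
theorem quenchedMeasure_path (ω : Env) (x : ℕ → ℤ) (n : ℕ) :
    quenchedMeasure ω {X | ∀ i ≤ n, X i = x i} =
      (if x 0 = 0 then 1 else 0) * ∏ i ∈ Finset.range n, stepLaw ω (x i) {x (i + 1)} := by
  rw [← partialTraj_singleton, ← Kernel.traj_map_frestrictLe_apply,
    Measure.map_apply (by fun_prop) (.singleton _)]
  unfold quenchedMeasure
  congr 1
  ext X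
  simp [funext_iff, Preorder.frestrictLe]

theorem measurable_quenchedMeasure : Measurable quenchedMeasure := by
  refine Measurable.measure_of_isPiSystem_of_isProbabilityMeasure
    generateFrom_measurableCylinders.symm isPiSystem_measurableCylinders fun s hs => ?_
  rw [measurableCylinders_nat] at hs
  simp only [Set.mem_iUnion, Set.mem_singleton_iff] at hs
  obtain ⟨n, S, hS, rfl⟩ := hs
  have h1 : ∀ ω, quenchedMeasure ω (cylinder (Finset.Iic n) S) =
      ∑' y : Finset.Iic n → ℤ, S.indicator (fun y => Kernel.partialTraj (X := fun _ => ℤ)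
        (stepKernel ω) 0 n (fun _ => 0) {y}) y := by
    intro ω
    rw [Measure.tsum_indicator_apply_singleton _ _ hS, ← Kernel.traj_map_frestrictLe_apply,
      Measure.map_apply (by fun_prop) hS]
    rfl
  simp_rw [h1]
  refine Measurable.tsum fun y => ?_
  by_cases hy : y ∈ S
  · simp only [Set.indicator_of_mem hy]
    obtain ⟨x, rfl⟩ : ∃ x : ℕ → ℤ, y = fun i : Finset.Iic n => x i :=
      ⟨fun i => if h : i ∈ Finset.Iic n then y ⟨i, h⟩ else 0, by funext i; simp⟩
    simp_rw [partialTraj_singleton]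
    refine Measurable.const_mul (Finset.measurable_prod _ fun i _ => ?_) _
    simp only [stepLaw, Measure.coe_add, Measure.coe_smul, Pi.add_apply, Pi.smul_apply,
      smul_eq_mul]
    fun_prop
  · simp only [Set.indicator_of_notMem hy, measurable_const]

/-- The quenched law as a Markov kernel from environments to paths. -/
def quenchedLaw : Kernel Env (ℕ → ℤ) := ⟨quenchedMeasure, measurable_quenchedMeasure⟩

/-- The annealed law `∫ P_ω(·) dν^{⊗ ℤ}(ω)` of the walk. -/
def annealedLaw (ν : ProbabilityMeasure (Set.Ioo (0 : ℝ) 1)) : Measure (ℕ → ℤ) :=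
  (envLaw ν).bind quenchedLaw

/-- `T_n = inf {t : X_t = n}` (with value `0` if the path never visits `n`). -/
def hittingTime (X : ℕ → ℤ) (n : ℕ) : ℕ := sInf {t : ℕ | X t = (n : ℤ)}

/-- `L_x^n`: the number of left steps from the site `x` before time `T_n`. -/
def leftSteps (X : ℕ → ℤ) (n x : ℕ) : ℕ :=
  ∑ t ∈ Finset.range (hittingTime X n),
    if X t = (x : ℤ) ∧ X (t + 1) = (x : ℤ) - 1 then 1 else 0

/-- `∫ a^(u+1) (1-a)^v dν(a)`. -/
def moment (ν : ProbabilityMeasure (Set.Ioo (0 : ℝ) 1)) (u v : ℕ) : ℝ :=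
  ∫ a, (a : ℝ) ^ (u + 1) * (1 - (a : ℝ)) ^ v ∂(ν : Measure (Set.Ioo (0 : ℝ) 1))

/-- `φ(u,v) = log ∫ a^(u+1) (1-a)^v dν(a)`. -/
def phi (ν : ProbabilityMeasure (Set.Ioo (0 : ℝ) 1)) (u v : ℕ) : ℝ :=
  Real.log (moment ν u v)

/-- The transition kernel `Q(u,v) = C(u+v,v) ∫ a^(u+1) (1-a)^v dν(a)` on the nonnegative
integers. -/
def Q (ν : ProbabilityMeasure (Set.Ioo (0 : ℝ) 1)) (u v : ℕ) : ℝ :=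
  ((u + v).choose v : ℝ) * moment ν u v

/-- `S = (1 + ρ_1 + ρ_1 ρ_2 + ⋯)⁻¹`, read as `0` where the series diverges. -/
def S (ω : Env) : ℝ :=
  (∑' k : ℕ, ∏ i ∈ Finset.Icc 1 k, rho ω (i : ℤ))⁻¹

/-- `π(u) = 𝔼[S (1-S)^u]`. -/
def invMeas (ν : ProbabilityMeasure (Set.Ioo (0 : ℝ) 1)) (u : ℕ) : ℝ :=
  ∫ ω, S ω * (1 - S ω) ^ u ∂(envLaw ν)

/-- `π̃(u,v) = π(u) Q(u,v)`. -/
def invMeasPair (ν : ProbabilityMeasure (Set.Ioo (0 : ℝ) 1)) (u v : ℕ) : ℝ :=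
  invMeas ν u * Q ν u v

/-- The walk is transient to the right and sub-ballistic, with the required integrability:
`𝔼|log ρ_0| < ∞`, `𝔼 log ρ_0 < 0` and `𝔼 ρ_0 ∈ [1, ∞)`. -/
structure TransientSubballistic (ν : ProbabilityMeasure (Set.Ioo (0 : ℝ) 1)) : Prop where
  integrable_log : Integrable (fun ω => Real.log (rho ω 0)) (envLaw ν)
  log_neg : ∫ ω, Real.log (rho ω 0) ∂(envLaw ν) < 0
  integrable_rho : Integrable (fun ω => rho ω 0) (envLaw ν)
  one_le_rho : 1 ≤ ∫ ω, rho ω 0 ∂(envLaw ν)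

/-- The difference criterion
`ℓ_n^sb(θ) = ∑_{x<n} [φ_θ(L_{x+1}^n, L_x^n) - φ_{θ₀}(L_{x+1}^n, L_x^n)]` at the path `X`. -/
def criterion {P : Type*} (ν : P → ProbabilityMeasure (Set.Ioo (0 : ℝ) 1)) (θ₀ : P) (n : ℕ)
    (X : ℕ → ℤ) (θ : P) : ℝ :=
  ∑ x ∈ Finset.range n,
    (phi (ν θ) (leftSteps X n (x + 1)) (leftSteps X n x) -
      phi (ν θ₀) (leftSteps X n (x + 1)) (leftSteps X n x))

end RWRE

end

/-! Stop the walk at `T_n` and read the left-step counts from right to left: `L_n = 0, L_{n-1}, …,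
L_0` is governed by the kernel `Q` started at `0` (a branching process with immigration, averaged
over the i.i.d. environment), and `π` is invariant for `Q`. The criterion is then an additive
functional of a Markov chain, and, recentred at the true parameter, its stationary mean per step is
minus a relative entropy.

Transfer to the chain needs only an upper bound. A nonnegative supermartingale
(`profileMartingale_step`, `sum_firstVisitProfile_le`) bounds the quenched probability of a count
vector by a product over sites; integration over the environment turns it into a product of `Q`'s.
Multiplied by `π(0)`, this is a cylinder probability of the stationary chain, so passing to
stationarity costs the constant factor `1/π(0)` (`TransientSubballistic.annealedLaw_sum_nonneg_le`).

For the stationary chain a weak law suffices (`tendsto_chainLaw_pathSum_nonneg`). Von Neumann's mean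
ergodic theorem applies to the transition operator on `L²(π)`; its fixed vectors are constants
because every pair of states has positive mass. Hence second moments of bounded centred path sums
are `o(n²)`, and truncation reaches integrable functionals.

Wald's argument finishes. Moments determine the site law, so the relative entropy is positive off
the true parameter (`TransientSubballistic.integral_phi_sub_neg`). Continuity and the integrable
envelope give, near each wrong parameter, a single dominating function of negative mean
(`exists_dominating_neg`); compactness leaves finitely many of them. A maximizer far from the truth
makes one of the corresponding sums nonnegative, an event of vanishing probability. -/

noncomputable section

namespace RWRE

/-! ### The transition operator on `L²(π)` and the mean ergodic theorem. -/

section MarkovChain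

variable {α : Type*} [MeasurableSpace α] {π : Measure α} [IsProbabilityMeasure π]
  {κ : Kernel α α} [IsMarkovKernel κ]

theorem measurePreserving_fst_compProd (π : Measure α) [IsProbabilityMeasure π]
    (κ : Kernel α α) [IsMarkovKernel κ] : MeasurePreserving Prod.fst (π ⊗ₘ κ) π :=
  ⟨measurable_fst, Measure.fst_compProd π κ⟩

theorem measurePreserving_snd_compProd (h : κ.Invariant π) :
    MeasurePreserving Prod.snd (π ⊗ₘ κ) π :=
  ⟨measurable_snd, (Measure.snd_compProd π κ).trans h⟩

/-- Composition with the first coordinate, from `L²(π)` to `L²(π ⊗ₘ κ)`. -/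
def liftFst (π : Measure α) [IsProbabilityMeasure π] (κ : Kernel α α) [IsMarkovKernel κ] :
    Lp ℝ 2 π →ₗᵢ[ℝ] Lp ℝ 2 (π ⊗ₘ κ) :=
  Lp.compMeasurePreservingₗᵢ ℝ Prod.fst (measurePreserving_fst_compProd π κ)

/-- Composition with the second coordinate, from `L²(π)` to `L²(π ⊗ₘ κ)`. -/
def liftSnd (h : κ.Invariant π) : Lp ℝ 2 π →ₗᵢ[ℝ] Lp ℝ 2 (π ⊗ₘ κ) :=
  Lp.compMeasurePreservingₗᵢ ℝ Prod.snd (measurePreserving_snd_compProd h)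

/-- The transition operator on `L²(π)`. -/
def transOp (h : κ.Invariant π) : Lp ℝ 2 π →L[ℝ] Lp ℝ 2 π :=
  (ContinuousLinearMap.adjoint (liftFst π κ).toContinuousLinearMap) ∘L
    (liftSnd h).toContinuousLinearMap

theorem inner_transOp (h : κ.Invariant π) (f g : Lp ℝ 2 π) :
    inner ℝ (transOp h f) g = inner ℝ (liftSnd h f) (liftFst π κ g) := by
  simp [transOp, ContinuousLinearMap.adjoint_inner_left]

/-- Both lifts are isometries, so Cauchy–Schwarz on the pair space gives `‖Tf‖² ≤ ‖f‖ ‖Tf‖`. -/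
theorem norm_transOp_le (h : κ.Invariant π) : ‖transOp h‖ ≤ 1 := by
  refine ContinuousLinearMap.opNorm_le_bound _ zero_le_one fun f => ?_
  have h1 : ‖transOp h f‖ * ‖transOp h f‖ ≤ ‖f‖ * ‖transOp h f‖ := by
    rw [← real_inner_self_eq_norm_mul_norm, inner_transOp]
    refine (real_inner_le_norm _ _).trans ?_
    simp
  rw [one_mul]
  by_contra! hlt
  have : 0 < ‖transOp h f‖ := (norm_nonneg f).trans_lt hlt
  nlinarith

/-- For a stationary pair `(X, Y)`, expanding `‖f(Y) - f(X)‖²` leaves `2‖f‖² - 2⟨Tf, f⟩`, which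
vanishes for a fixed vector. Reversibility plays no role. -/
theorem liftSnd_eq_liftFst_of_fixed (h : κ.Invariant π) {f : Lp ℝ 2 π}
    (hf : transOp h f = f) : liftSnd h f = liftFst π κ f := by
  have h1 : inner ℝ (liftSnd h f) (liftFst π κ f) = ‖f‖ * ‖f‖ := by
    rw [← inner_transOp, hf, real_inner_self_eq_norm_mul_norm]
  rw [← sub_eq_zero, ← norm_eq_zero, ← mul_self_eq_zero, norm_sub_mul_self_real, h1]
  simp; ring

theorem coeFn_liftFst (f : Lp ℝ 2 π) :
    (liftFst π κ f : α × α → ℝ) =ᵐ[π ⊗ₘ κ] fun p => f p.1 :=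
  Lp.coeFn_compMeasurePreserving f (measurePreserving_fst_compProd π κ)

theorem coeFn_liftSnd (h : κ.Invariant π) (f : Lp ℝ 2 π) :
    (liftSnd h f : α × α → ℝ) =ᵐ[π ⊗ₘ κ] fun p => f p.2 :=
  Lp.coeFn_compMeasurePreserving f (measurePreserving_snd_compProd h)

theorem forall_of_ae_of_singleton {β : Type*} [MeasurableSpace β] {μ : Measure β}
    (hpos : ∀ b, μ {b} ≠ 0) {p : β → Prop} (h : ∀ᵐ b ∂μ, p b) (b : β) : p b := by
  by_contra hb
  exact hpos b (measure_mono_null (by simpa using hb) (ae_iff.1 h))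

/-- Since every pair is charged, the almost sure identity `f(Y) = f(X)` holds at every pair; one
step already connects any two states. -/
theorem const_of_fixed (h : κ.Invariant π) (hpos : ∀ p, (π ⊗ₘ κ) {p} ≠ 0) {f : Lp ℝ 2 π}
    (hf : transOp h f = f) (u v : α) : f u = f v := by
  have h1 : ∀ᵐ p ∂(π ⊗ₘ κ), f p.2 = f p.1 := by
    filter_upwards [coeFn_liftFst (κ := κ) f, coeFn_liftSnd h f] with p h1 h2
    rw [← h1, ← h2, liftSnd_eq_liftFst_of_fixed h hf]
  exact forall_of_ae_of_singleton hpos h1 (v, u)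

theorem inner_eq_zero_of_integral (h : κ.Invariant π) (hpos : ∀ p, (π ⊗ₘ κ) {p} ≠ 0)
    {f g : Lp ℝ 2 π} (hf : transOp h f = f) (hg : ∫ a, g a ∂π = 0) : inner ℝ f g = (0 : ℝ) := by
  rw [L2.inner_def]
  rcases isEmpty_or_nonempty α with hα | ⟨⟨a⟩⟩
  · simp [Measure.eq_zero_of_isEmpty π]
  · have : (fun x => inner ℝ (f x) (g x)) = fun x => f a * g x := by
      funext x
      rw [const_of_fixed h hpos hf x a]
      simp [mul_comm]
    rw [this, integral_const_mul, hg, mul_zero]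

/-- The averages converge to the projection on the fixed space, which contains only constants; a
function of mean zero is orthogonal to it. -/
theorem tendsto_birkhoffAverage_transOp (h : κ.Invariant π) (hpos : ∀ p, (π ⊗ₘ κ) {p} ≠ 0)
    {g : Lp ℝ 2 π} (hg : ∫ a, g a ∂π = 0) :
    Tendsto (birkhoffAverage ℝ (transOp h) _root_.id · g) atTop (𝓝 0) := by
  have h1 := (transOp h).tendsto_birkhoffAverage_orthogonalProjection (norm_transOp_le h) g
  have h2 : g ∈ ((transOp h).eqLocus (1 : Lp ℝ 2 π →L[ℝ] Lp ℝ 2 π))ᗮ := by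
    rw [Submodule.mem_orthogonal]
    intro f hf
    exact inner_eq_zero_of_integral h hpos hf hg
  have h3 := Submodule.orthogonalProjectionOnto_eq_zero_iff.2 h2
  rwa [h3] at h1

/-- One step of the chain applied to a function. -/
def avg (κ : Kernel α α) (f : α → ℝ) (u : α) : ℝ := ∫ v, f v ∂(κ u)

theorem abs_avg_le {f : α → ℝ} {C : ℝ} (hC : ∀ a, |f a| ≤ C) (u : α) : |avg κ f u| ≤ C := by
  simpa [avg] using norm_integral_le_of_norm_le_const (μ := κ u)
    (Eventually.of_forall fun a => (Real.norm_eq_abs (f a)).trans_le (hC a))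

theorem abs_iterate_avg_le {f : α → ℝ} {C : ℝ} (hC : ∀ a, |f a| ≤ C) (j : ℕ) (u : α) :
    |(avg κ)^[j] f u| ≤ C := by
  induction j generalizing u with
  | zero => exact hC u
  | succ j ih =>
    rw [Function.iterate_succ_apply']
    exact abs_avg_le ih u

variable [Countable α] [MeasurableSingletonClass α]

theorem memLp_of_bounded {β : Type*} [MeasurableSpace β] [Countable β]
    [MeasurableSingletonClass β] {μ : Measure β} [IsFiniteMeasure μ] {f : β → ℝ} {C : ℝ}
    (hC : ∀ a, |f a| ≤ C) (p : ℝ≥0∞) : MemLp f p μ :=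
  MemLp.of_bound (measurable_of_countable f).aestronglyMeasurable C (Eventually.of_forall hC)

/-- Disintegrating `π ⊗ₘ κ` identifies the operator defined through an adjoint with the pointwise
kernel average. -/
theorem transOp_toLp (h : κ.Invariant π) {f : α → ℝ} {C : ℝ} (hC : ∀ a, |f a| ≤ C) :
    transOp h ((memLp_of_bounded hC 2).toLp f) =
      (memLp_of_bounded (abs_avg_le (κ := κ) hC) 2).toLp (avg κ f) := by
  refine ext_inner_right ℝ fun g => ?_
  rw [inner_transOp, L2.inner_def, L2.inner_def]
  have h1 : ∀ᵐ p : α × α ∂(π ⊗ₘ κ), ((memLp_of_bounded hC 2).toLp f : Lp ℝ 2 π) p.2 = f p.2 :=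
    (measurePreserving_snd_compProd h).quasiMeasurePreserving.ae
      (p := fun a => ((memLp_of_bounded hC 2).toLp f : Lp ℝ 2 π) a = f a) (MemLp.coeFn_toLp _)
  have h2 : (fun p : α × α => inner ℝ (liftSnd h ((memLp_of_bounded hC 2).toLp f) p)
      (liftFst π κ g p)) =ᵐ[π ⊗ₘ κ] fun p => g p.1 * f p.2 := by
    filter_upwards [coeFn_liftFst (κ := κ) g, coeFn_liftSnd h ((memLp_of_bounded hC 2).toLp f),
      h1] with p h1 h2 h3
    rw [h1, h2, h3]
    simp
  have hfp : MemLp (fun p : α × α => f p.2) 2 (π ⊗ₘ κ) :=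
    memLp_of_bounded (fun p : α × α => hC p.2) 2
  have hgp : MemLp (fun p : α × α => g p.1) 2 (π ⊗ₘ κ) :=
    (Lp.memLp g).comp_measurePreserving (measurePreserving_fst_compProd π κ)
  have hint : Integrable (fun p : α × α => g p.1 * f p.2) (π ⊗ₘ κ) := hgp.integrable_mul hfp
  rw [integral_congr_ae h2, Measure.integral_compProd hint]
  refine integral_congr_ae ?_
  filter_upwards [MemLp.coeFn_toLp (memLp_of_bounded (μ := π) (abs_avg_le (κ := κ) hC) 2)]
    with a ha
  rw [ha, integral_const_mul]
  simp [avg]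

theorem iterate_transOp_toLp (h : κ.Invariant π) {f : α → ℝ} {C : ℝ} (hC : ∀ a, |f a| ≤ C)
    (j : ℕ) :
    (transOp h)^[j] ((memLp_of_bounded hC 2).toLp f) =
      (memLp_of_bounded (abs_iterate_avg_le (κ := κ) hC j) 2).toLp ((avg κ)^[j] f) := by
  induction j with
  | zero => rfl
  | succ j ih =>
    rw [Function.iterate_succ_apply', ih,
      transOp_toLp h (abs_iterate_avg_le hC j)]
    simp only [Function.iterate_succ_apply']

end MarkovChain

/-! ### Additive functionals of a path. -/

section PathSum

/-- The additive functional `∑_{k<n} g(z_k, z_{k+1})`. -/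
def pathSum {α : Type*} (g : α × α → ℝ) (n : ℕ) (z : ℕ → α) : ℝ :=
  ∑ k ∈ Finset.range n, g (z k, z (k + 1))

theorem abs_pathSum_le {α : Type*} {g : α × α → ℝ} {C : ℝ} (hC : ∀ p, |g p| ≤ C) (n : ℕ)
    (z : ℕ → α) :
    |pathSum g n z| ≤ n * C := by
  refine (Finset.abs_sum_le_sum_abs _ _).trans ((Finset.sum_le_sum fun k _ => hC _).trans ?_)
  simp

theorem pathSum_update {α : Type*} (g : α × α → ℝ) (n : ℕ) (z : ℕ → α) (v : α) :
    pathSum g (n + 1) (Function.update z (n + 1) v) = pathSum g n z + g (z n, v) := by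
  unfold pathSum
  rw [Finset.sum_range_succ]
  congr 1
  · refine Finset.sum_congr rfl fun k hk => ?_
    have := Finset.mem_range.1 hk
    rw [Function.update_of_ne (by omega), Function.update_of_ne (by omega)]
  · simp

end PathSum

/-! ### The finite-horizon chain: marginals, cylinders and second moments. -/

section ChainLaw

variable {α : Type*} [MeasurableSpace α]

/-- The law of the first `n + 1` states of the chain with initial law `π` and transition kernel
`κ`, as a law on sequences whose later entries are irrelevant. -/
def chainLaw (π : Measure α) (κ : Kernel α α) : ℕ → Measure (ℕ → α)
  | 0 => π.map fun a _ => a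
  | n + 1 => (chainLaw π κ n ⊗ₘ κ.comap (fun z : ℕ → α => z n) (measurable_pi_apply n)).map
      fun p => Function.update p.1 (n + 1) p.2

variable {π : Measure α} [IsProbabilityMeasure π] {κ : Kernel α α} [IsMarkovKernel κ]

theorem measurable_update_pair (n : ℕ) :
    Measurable fun p : (ℕ → α) × α => Function.update p.1 n p.2 :=
  measurable_update'

instance (n : ℕ) : IsProbabilityMeasure (chainLaw π κ n) := by
  induction n with
  | zero => exact Measure.isProbabilityMeasure_map (by fun_prop)
  | succ n ih => exact Measure.isProbabilityMeasure_map (measurable_update_pair _).aemeasurable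

theorem integral_chainLaw_succ {n : ℕ} {F : (ℕ → α) → ℝ} (hF : Measurable F) {C : ℝ}
    (hC : ∀ z, |F z| ≤ C) :
    ∫ z, F z ∂(chainLaw π κ (n + 1)) =
      ∫ z, ∫ v, F (Function.update z (n + 1) v) ∂(κ (z n)) ∂(chainLaw π κ n) := by
  rw [chainLaw, integral_map (measurable_update_pair _).aemeasurable hF.aestronglyMeasurable,
    Measure.integral_compProd]
  · rfl
  · exact Integrable.of_bound (hF.comp (measurable_update_pair _)).aestronglyMeasurable C
      (Eventually.of_forall fun p => (Real.norm_eq_abs _).trans_le (hC _))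

theorem lintegral_chainLaw_succ {n : ℕ} {F : (ℕ → α) → ℝ≥0∞} (hF : Measurable F) :
    ∫⁻ z, F z ∂(chainLaw π κ (n + 1)) =
      ∫⁻ z, ∫⁻ v, F (Function.update z (n + 1) v) ∂(κ (z n)) ∂(chainLaw π κ n) := by
  have hm : Measurable fun p : (ℕ → α) × α => F (Function.update p.1 (n + 1) p.2) :=
    hF.comp (measurable_update_pair _)
  rw [chainLaw, lintegral_map hF (measurable_update_pair _), Measure.lintegral_compProd hm]
  rfl

theorem lintegral_chainLaw_pair (h : κ.Invariant π) {F : α × α → ℝ≥0∞} (hF : Measurable F)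
    {n k : ℕ} (hk : k < n) :
    ∫⁻ z, F (z k, z (k + 1)) ∂(chainLaw π κ n) = ∫⁻ p, F p ∂(π ⊗ₘ κ) := by
  have hmarg : ∀ n, ∀ f : α → ℝ≥0∞, Measurable f →
      ∫⁻ z, f (z n) ∂(chainLaw π κ n) = ∫⁻ a, f a ∂π := by
    intro n
    induction n with
    | zero =>
      intro f hf
      rw [chainLaw, lintegral_map (by fun_prop) (by fun_prop)]
    | succ n ih =>
      intro f hf
      rw [lintegral_chainLaw_succ (by fun_prop)]
      simp only [Function.update_self]
      rw [ih (fun u => ∫⁻ v, f v ∂(κ u)) hf.lintegral_kernel, ← Measure.lintegral_bind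
        κ.measurable.aemeasurable hf.aemeasurable]
      rw [h]
  induction n with
  | zero => omega
  | succ n ih =>
    rw [lintegral_chainLaw_succ (by fun_prop)]
    rcases Nat.lt_succ_iff_lt_or_eq.1 hk with hlt | rfl
    · rw [← ih hlt]
      refine lintegral_congr fun z => ?_
      have h1 : k ≠ n + 1 := by omega
      have h2 : k + 1 ≠ n + 1 := by omega
      simp [Function.update_of_ne h1, Function.update_of_ne h2]
    · rw [Measure.lintegral_compProd hF, ← hmarg k (fun u => ∫⁻ v, F (u, v) ∂(κ u))
        hF.lintegral_kernel_prod_right']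
      refine lintegral_congr fun z => ?_
      simp

theorem integral_chainLaw_last (h : κ.Invariant π) {n : ℕ} {f : α → ℝ} (hf : Measurable f) :
    ∫ z, f (z n) ∂(chainLaw π κ n) = ∫ a, f a ∂π := by
  have hmap : (chainLaw π κ n).map (fun z => z n) = π := by
    induction n with
    | zero =>
      rw [chainLaw, Measure.map_map (by fun_prop) (by fun_prop)]
      exact Measure.map_id
    | succ n ih =>
      refine Measure.ext_of_lintegral _ fun f hf => ?_
      rw [lintegral_map hf (by fun_prop), lintegral_chainLaw_succ (by fun_prop)]
      simp only [Function.update_self]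
      conv_rhs => rw [← h, Measure.lintegral_bind κ.measurable.aemeasurable hf.aemeasurable, ← ih]
      rw [lintegral_map hf.lintegral_kernel (by fun_prop)]
  conv_rhs => rw [← hmap]
  rw [integral_map (measurable_pi_apply n).aemeasurable hf.aestronglyMeasurable]

variable [MeasurableSingletonClass α]

theorem chainLaw_cylinder (x : ℕ → α) (n : ℕ) :
    chainLaw π κ n {z | ∀ k ≤ n, z k = x k} =
      π {x 0} * ∏ k ∈ Finset.range n, κ (x k) {x (k + 1)} := by
  have hmeas : ∀ n, MeasurableSet {z : ℕ → α | ∀ k ≤ n, z k = x k} := by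
    intro n
    have : {z : ℕ → α | ∀ k ≤ n, z k = x k} = ⋂ k ∈ Set.Iic n, (fun z => z k) ⁻¹' {x k} := by
      ext; simp
    rw [this]
    exact MeasurableSet.biInter (Set.to_countable _) fun k _ =>
      measurable_pi_apply k (measurableSet_singleton _)
  induction n with
  | zero =>
    rw [chainLaw, Measure.map_apply (by fun_prop) (hmeas 0)]
    simp only [Finset.range_zero, Finset.prod_empty, mul_one]
    congr 1
    ext; simp
  | succ n ih =>
    rw [← lintegral_indicator_one (hmeas _), lintegral_chainLaw_succ
      (measurable_one.indicator (hmeas _)), Finset.prod_range_succ, ← mul_assoc, ← ih,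
      ← lintegral_indicator_one (hmeas n), ← lintegral_mul_const _
      (measurable_one.indicator (hmeas n))]
    refine lintegral_congr fun z => ?_
    by_cases hz : ∀ k ≤ n, z k = x k
    · rw [Set.indicator_of_mem (show z ∈ {z | ∀ k ≤ n, z k = x k} from hz), ← hz n le_rfl]
      simp only [Pi.one_apply, one_mul]
      rw [← lintegral_indicator_one (measurableSet_singleton _)]
      refine lintegral_congr fun v => ?_
      by_cases hv : v = x (n + 1)
      · rw [Set.indicator_of_mem (s := {x (n + 1)}) (by simpa using hv), Set.indicator_of_mem]
        · rfl
        intro k hk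
        rcases Nat.le_succ_iff.1 hk with h1 | rfl
        · rw [Function.update_of_ne (by omega)]; exact hz k h1
        · simpa using hv
      · rw [Set.indicator_of_notMem (s := {x (n + 1)}) (by simpa using hv),
          Set.indicator_of_notMem]
        intro hmem
        exact hv (by simpa using hmem (n + 1) le_rfl)
    · rw [Set.indicator_of_notMem (show z ∉ {z | ∀ k ≤ n, z k = x k} from hz), zero_mul]
      refine (lintegral_congr fun v => ?_).trans lintegral_zero
      rw [Set.indicator_of_notMem]
      intro hmem
      refine hz fun k hk => ?_
      have := hmem k (by omega)
      rwa [Function.update_of_ne (by omega)] at this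

variable [Countable α]

theorem measurable_pathSum (g : α × α → ℝ) (n : ℕ) : Measurable (pathSum g n) := by
  have := measurable_of_countable g
  unfold pathSum
  fun_prop

/-- Conditioning successively on the past carries `f` back from time `n` to time `k + 1`, where it
has become its `(n - 1 - k)`-th kernel iterate; by stationarity all pairs have the same law, so the
terms collect into one integral. -/
theorem integral_pathSum_mul (h : κ.Invariant π) {g : α × α → ℝ} {C : ℝ} (hg : ∀ p, |g p| ≤ C)
    (n : ℕ) {f : α → ℝ} {D : ℝ} (hf : ∀ a, |f a| ≤ D) :
    ∫ z, pathSum g n z * f (z n) ∂(chainLaw π κ n) =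
      ∫ p, g p * (∑ j ∈ Finset.range n, (avg κ)^[j] f p.2) ∂(π ⊗ₘ κ) := by
  induction n generalizing f with
  | zero => simp [pathSum]
  | succ n ih =>
    have hfm := measurable_of_countable f
    have hgm := measurable_of_countable g
    have hC0 : ∀ z : ℕ → α, 0 ≤ C := fun z => (abs_nonneg _).trans (hg (z 0, z 0))
    rw [integral_chainLaw_succ (F := fun z => pathSum g (n + 1) z * f (z (n + 1)))
      ((measurable_pathSum g _).mul (by fun_prop)) (C := (n + 1 : ℕ) * C * D)]
    swap
    · intro z
      rw [abs_mul]
      exact mul_le_mul (abs_pathSum_le hg _ z) (hf _) (abs_nonneg _)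
        (mul_nonneg (Nat.cast_nonneg _) (hC0 z))
    simp only [pathSum_update, Function.update_self]
    have h1 : ∀ z : ℕ → α, ∫ v, (pathSum g n z + g (z n, v)) * f v ∂(κ (z n)) =
        pathSum g n z * avg κ f (z n) + avg κ (fun v => g (z n, v) * f v) (z n) := by
      intro z
      simp only [add_mul]
      rw [integral_add, integral_const_mul]
      · rfl
      · exact ((memLp_of_bounded hf 1).integrable le_rfl).const_mul _
      · refine (memLp_of_bounded (C := C * D) (fun v => ?_) 1).integrable le_rfl
        rw [abs_mul]
        exact mul_le_mul (hg _) (hf _) (abs_nonneg _) (hC0 z)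
    have hb : ∀ u, |avg κ (fun v => g (u, v) * f v) u| ≤ C * D := fun u =>
      abs_avg_le (κ := κ) (fun v => by
        rw [abs_mul]
        exact mul_le_mul (hg _) (hf _) (abs_nonneg _) (hC0 fun _ => u)) u
    simp only [h1]
    rw [integral_add, ih (abs_avg_le hf),
      integral_chainLaw_last h (f := fun u => avg κ (fun v => g (u, v) * f v) u)
        (measurable_of_countable _)]
    · simp only [Finset.sum_range_succ', mul_add, ← Function.iterate_succ_apply]
      rw [integral_add]
      · congr 1
        rw [Measure.integral_compProd]
        · rfl
        · refine (memLp_of_bounded (C := C * D) (fun v => ?_) 1).integrable le_rfl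
          rw [abs_mul]
          exact mul_le_mul (hg _) (hf _) (abs_nonneg _) (hC0 fun _ => v.1)
      · refine (memLp_of_bounded (C := C * (n * D)) (fun p => ?_) 1).integrable le_rfl
        rw [abs_mul]
        refine mul_le_mul (hg _) ?_ (abs_nonneg _) (hC0 fun _ => p.1)
        refine (Finset.abs_sum_le_sum_abs _ _).trans
          ((Finset.sum_le_sum fun k _ => abs_iterate_avg_le hf _ _).trans ?_)
        simp
      · refine (memLp_of_bounded (C := C * D) (fun v => ?_) 1).integrable le_rfl
        rw [abs_mul]
        exact mul_le_mul (hg _) (hf _) (abs_nonneg _) (hC0 fun _ => v.1)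
    · refine Integrable.of_bound ((measurable_pathSum g n).mul
        ((measurable_of_countable (avg κ f)).comp (measurable_pi_apply n))).aestronglyMeasurable
        (n * C * D) (Eventually.of_forall fun z => ?_)
      rw [Real.norm_eq_abs, abs_mul]
      exact mul_le_mul (abs_pathSum_le hg _ z) (abs_avg_le hf _) (abs_nonneg _)
        (mul_nonneg (Nat.cast_nonneg _) (hC0 z))
    · exact Integrable.of_bound ((measurable_of_countable
        (fun u => avg κ (fun v => g (u, v) * f v) u)).comp
          (measurable_pi_apply n)).aestronglyMeasurable
        (C * D) (Eventually.of_forall fun z => (Real.norm_eq_abs _).trans_le (hb _))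

theorem integral_pathSum_sq_succ (h : κ.Invariant π) {g : α × α → ℝ} {C : ℝ}
    (hg : ∀ p, |g p| ≤ C) (n : ℕ) :
    ∫ z, pathSum g (n + 1) z ^ 2 ∂(chainLaw π κ (n + 1)) =
      ∫ z, pathSum g n z ^ 2 ∂(chainLaw π κ n) +
        2 * ∫ z, pathSum g n z * avg κ (fun v => g (z n, v)) (z n) ∂(chainLaw π κ n) +
        ∫ p, g p ^ 2 ∂(π ⊗ₘ κ) := by
  have hgm := measurable_of_countable g
  have hC0 : ∀ z : ℕ → α, 0 ≤ C := fun z => (abs_nonneg _).trans (hg (z 0, z 0))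
  have hsq : ∀ {x B : ℝ}, |x| ≤ B → |x ^ 2| ≤ B ^ 2 := fun {x B} hx => by
    rw [abs_pow]; exact pow_le_pow_left₀ (abs_nonneg _) hx 2
  rw [integral_chainLaw_succ ((measurable_pathSum g _).pow_const 2)
    (fun z => hsq (abs_pathSum_le hg _ z))]
  simp only [pathSum_update]
  have h1 : ∀ z : ℕ → α, ∫ v, (pathSum g n z + g (z n, v)) ^ 2 ∂(κ (z n)) =
      pathSum g n z ^ 2 + 2 * (pathSum g n z * avg κ (fun v => g (z n, v)) (z n)) +
        avg κ (fun v => g (z n, v) ^ 2) (z n) := by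
    intro z
    have e : ∀ v, (pathSum g n z + g (z n, v)) ^ 2 =
      pathSum g n z ^ 2 + (2 * pathSum g n z) * g (z n, v) + g (z n, v) ^ 2 := fun v => by ring
    have i1 : Integrable (fun v => g (z n, v)) (κ (z n)) :=
      (memLp_of_bounded (fun v => hg (z n, v)) 1).integrable le_rfl
    have i2 : Integrable (fun v => g (z n, v) ^ 2) (κ (z n)) :=
      (memLp_of_bounded (fun v => hsq (hg (z n, v))) 1).integrable le_rfl
    have i3 : Integrable (fun v => pathSum g n z ^ 2 + (2 * pathSum g n z) * g (z n, v))
        (κ (z n)) := (integrable_const _).add (i1.const_mul _)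
    simp only [e]
    rw [integral_add i3 i2,
      integral_add (integrable_const _) (i1.const_mul _), integral_const_mul]
    simp [avg]
    ring
  simp only [h1]
  have m1 := measurable_pathSum g n
  have m2 : Measurable fun z : ℕ → α => avg κ (fun v => g (z n, v)) (z n) :=
    (measurable_of_countable (fun u => avg κ (fun v => g (u, v)) u)).comp (measurable_pi_apply n)
  have m3 : Measurable fun z : ℕ → α => avg κ (fun v => g (z n, v) ^ 2) (z n) :=
    (measurable_of_countable (fun u => avg κ (fun v => g (u, v) ^ 2) u)).comp
      (measurable_pi_apply n)
  have i1 : Integrable (fun z => pathSum g n z ^ 2) (chainLaw π κ n) :=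
    Integrable.of_bound (m1.pow_const 2).aestronglyMeasurable ((n * C) ^ 2)
      (Eventually.of_forall fun z => hsq (abs_pathSum_le hg n z))
  have i2 : Integrable (fun z => pathSum g n z * avg κ (fun v => g (z n, v)) (z n))
      (chainLaw π κ n) :=
    Integrable.of_bound (m1.mul m2).aestronglyMeasurable (n * C * C)
      (Eventually.of_forall fun z => by
        rw [Real.norm_eq_abs, abs_mul]
        exact mul_le_mul (abs_pathSum_le hg _ z) (abs_avg_le (fun v => hg (z n, v)) _)
          (abs_nonneg _) (mul_nonneg (Nat.cast_nonneg _) (hC0 z)))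
  have i3 : Integrable (fun z => avg κ (fun v => g (z n, v) ^ 2) (z n)) (chainLaw π κ n) :=
    Integrable.of_bound m3.aestronglyMeasurable (C ^ 2)
      (Eventually.of_forall fun z => abs_avg_le (fun v => hsq (hg (z n, v))) _)
  have i4 : Integrable (fun z => pathSum g n z ^ 2 +
      2 * (pathSum g n z * avg κ (fun v => g (z n, v)) (z n))) (chainLaw π κ n) :=
    i1.add (i2.const_mul 2)
  rw [integral_add i4 i3, integral_add i1 (i2.const_mul 2),
    integral_const_mul, integral_chainLaw_last h (f := fun u => avg κ (fun v => g (u, v) ^ 2) u)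
      (measurable_of_countable _), Measure.integral_compProd]
  · rfl
  · exact (memLp_of_bounded (fun p => hsq (hg p)) 1).integrable le_rfl

end ChainLaw

/-! ### The weak law of large numbers for the stationary chain. -/

section LawOfLargeNumbers

variable {α : Type*} [MeasurableSpace α] {π : Measure α} [IsProbabilityMeasure π]
  {κ : Kernel α α} [IsMarkovKernel κ]

theorem measurePreserving_chainLaw_pair (h : κ.Invariant π) {n k : ℕ} (hk : k < n) :
    MeasurePreserving (fun z : ℕ → α => (z k, z (k + 1))) (chainLaw π κ n) (π ⊗ₘ κ) := by
  refine ⟨by fun_prop, Measure.ext_of_lintegral _ fun F hF => ?_⟩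
  rw [lintegral_map hF (by fun_prop), lintegral_chainLaw_pair h hF hk]

variable [Countable α] [MeasurableSingletonClass α]

/-- Cauchy–Schwarz on the pair space: the sum of kernel iterates is `n` times a Birkhoff average,
and lifting to the second coordinate preserves its norm. -/
theorem integral_mul_sum_avg_le (h : κ.Invariant π) {g : α × α → ℝ} {C : ℝ}
    (hg : ∀ p, |g p| ≤ C) {f : α → ℝ} {D : ℝ} (hf : ∀ a, |f a| ≤ D) (n : ℕ) :
    ∫ p, g p * (∑ j ∈ Finset.range n, (avg κ)^[j] f p.2) ∂(π ⊗ₘ κ) ≤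
      ‖(memLp_of_bounded hg 2).toLp (μ := π ⊗ₘ κ) g‖ *
        (n * ‖birkhoffAverage ℝ (transOp h) _root_.id n ((memLp_of_bounded hf 2).toLp f)‖) := by
  set G := (memLp_of_bounded hg 2).toLp (μ := π ⊗ₘ κ) g with hG
  set F := (memLp_of_bounded hf 2).toLp (μ := π) f with hF
  have hB : n * ‖birkhoffAverage ℝ (transOp h) _root_.id n F‖ =
      ‖∑ j ∈ Finset.range n, (transOp h)^[j] F‖ := by
    rcases Nat.eq_zero_or_pos n with rfl | hn
    · simp
    · have hn' : (n : ℝ) ≠ 0 := by positivity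
      rw [birkhoffAverage, birkhoffSum, norm_smul]
      simp only [_root_.id]
      rw [norm_inv, Real.norm_natCast, ← mul_assoc, mul_inv_cancel₀ hn', one_mul]
  rw [hB, ← (liftSnd h).norm_map]
  refine le_of_eq_of_le ?_ (real_inner_le_norm _ _)
  rw [L2.inner_def]
  refine integral_congr_ae ?_
  have h1 : ∀ᵐ p : α × α ∂(π ⊗ₘ κ), (∑ j ∈ Finset.range n, (transOp h)^[j] F : Lp ℝ 2 π) p.2 =
      ∑ j ∈ Finset.range n, (avg κ)^[j] f p.2 := by
    refine (measurePreserving_snd_compProd h).quasiMeasurePreserving.ae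
      (p := fun a => (∑ j ∈ Finset.range n, (transOp h)^[j] F : Lp ℝ 2 π) a =
      ∑ j ∈ Finset.range n, (avg κ)^[j] f a) ?_
    have h2 : ∀ j, ∀ᵐ a ∂π, ((transOp h)^[j] F : Lp ℝ 2 π) a = (avg κ)^[j] f a := by
      intro j
      rw [hF, iterate_transOp_toLp h hf j]
      exact MemLp.coeFn_toLp _
    filter_upwards [ae_all_iff.2 h2, Lp.coeFn_finsetSum (Finset.range n)
      (fun j => (transOp h)^[j] F)] with a h3 h4
    rw [h4, Finset.sum_apply]
    exact Finset.sum_congr rfl fun j _ => h3 j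
  filter_upwards [h1, coeFn_liftSnd h (∑ j ∈ Finset.range n, (transOp h)^[j] F),
    MemLp.coeFn_toLp (memLp_of_bounded (μ := π ⊗ₘ κ) hg 2)] with p h1 h2 h3
  rw [h2, h1, hG, h3]
  simp [mul_comm]

/-- The second moment grows at step `n` by at most `2K n a_n + C²`, where `a_n` is the norm of the
`n`-th Birkhoff average of the conditional mean of `g`. Since `a_n → 0`, its Cesàro means vanish
too, and no rate of mixing is required. -/
theorem tendsto_integral_pathSum_sq (h : κ.Invariant π) (hpos : ∀ p, (π ⊗ₘ κ) {p} ≠ 0)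
    {g : α × α → ℝ} {C : ℝ} (hg : ∀ p, |g p| ≤ C) (hg0 : ∫ p, g p ∂(π ⊗ₘ κ) = 0) :
    Tendsto (fun n : ℕ => (∫ z, pathSum g n z ^ 2 ∂(chainLaw π κ n)) / (n : ℝ) ^ 2)
      atTop (𝓝 0) := by
  set f : α → ℝ := fun u => avg κ (fun v => g (u, v)) u with hf
  have hfb : ∀ u, |f u| ≤ C := fun u => abs_avg_le (fun v => hg (u, v)) u
  set F := (memLp_of_bounded hfb 2).toLp (μ := π) f with hF
  set K := ‖(memLp_of_bounded hg 2).toLp (μ := π ⊗ₘ κ) g‖ with hK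
  set a : ℕ → ℝ := fun n => ‖birkhoffAverage ℝ (transOp h) _root_.id n F‖ with ha
  set x : ℕ → ℝ := fun n => ∫ z, pathSum g n z ^ 2 ∂(chainLaw π κ n) with hx
  have hF0 : ∫ u, F u ∂π = 0 := by
    rw [integral_congr_ae (MemLp.coeFn_toLp _), ← hg0, Measure.integral_compProd]
    · rfl
    · exact (memLp_of_bounded hg 1).integrable le_rfl
  have ha0 : Tendsto a atTop (𝓝 0) := by
    simpa using (tendsto_birkhoffAverage_transOp h hpos hF0).norm
  have hstep : ∀ n, x (n + 1) ≤ x n + (2 * K * (n * a n) + C ^ 2) := by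
    intro n
    have h1 := integral_pathSum_sq_succ h hg n
    have h2 := integral_pathSum_mul h hg n hfb
    have h3 := integral_mul_sum_avg_le h hg hfb n
    have h4 : ∫ p, g p ^ 2 ∂(π ⊗ₘ κ) ≤ C ^ 2 := by
      have : ∫ p, g p ^ 2 ∂(π ⊗ₘ κ) ≤ ∫ _, C ^ 2 ∂(π ⊗ₘ κ) := by
        refine integral_mono_of_nonneg (Eventually.of_forall fun p => sq_nonneg _)
          (integrable_const _) (Eventually.of_forall fun p => ?_)
        exact sq_le_sq' (abs_le.1 (hg p)).1 (abs_le.1 (hg p)).2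
      simpa using this
    simp only [hx]
    rw [h1]
    simp only [hf] at h2 h3
    rw [h2]
    have h5 : K * (n * a n) = K * (n * ‖birkhoffAverage ℝ (transOp h) _root_.id n F‖) := rfl
    linarith
  -- The factor `k` in the `k`-th increment is crudely replaced by `n`, so that a Cesàro mean of `a`
  -- appears after division by `n²`.
  have hsum : ∀ n, x n ≤ n * (2 * K * ∑ k ∈ Finset.range n, a k) + n * C ^ 2 := by
    intro n
    induction n with
    | zero => simp [hx, pathSum]
    | succ n ih =>
      have h0 : 0 ≤ ∑ k ∈ Finset.range n, a k := Finset.sum_nonneg fun k _ => norm_nonneg _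
      have h1 : 0 ≤ a n := norm_nonneg _
      have h2 : 0 ≤ K := norm_nonneg _
      rw [Finset.sum_range_succ]
      push_cast
      have := hstep n
      nlinarith [mul_nonneg h2 h0, mul_nonneg h2 h1]
  have hlim : Tendsto (fun n : ℕ => 2 * K * ((n : ℝ)⁻¹ * ∑ k ∈ Finset.range n, a k) +
      C ^ 2 * (n : ℝ)⁻¹) atTop (𝓝 0) := by
    have := ((ha0.cesaro).const_mul (2 * K)).add
      ((tendsto_inv_atTop_nhds_zero_nat (𝕜 := ℝ)).const_mul (C ^ 2))
    simpa using this
  refine squeeze_zero' (Eventually.of_forall fun n => ?_) ?_ hlim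
  · exact div_nonneg (integral_nonneg fun z => sq_nonneg _) (sq_nonneg _)
  · filter_upwards [eventually_gt_atTop 0] with n hn
    have hn' : (0 : ℝ) < n := by exact_mod_cast hn
    rw [div_le_iff₀ (by positivity)]
    refine (hsum n).trans (le_of_eq ?_)
    field_simp

theorem exists_truncation_integral_le {β : Type*} [MeasurableSpace β] [Countable β]
    [MeasurableSingletonClass β] {μ : Measure β} {g : β → ℝ} (hg : Integrable g μ) {δ : ℝ}
    (hδ : 0 < δ) :
    ∃ (f : β → ℝ) (C : ℝ), (∀ p, |f p| ≤ C) ∧ ∫ p, |g p - f p| ∂μ ≤ δ := by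
  set f : ℕ → β → ℝ := fun N p => if |g p| ≤ N then g p else 0 with hf
  have h1 : Tendsto (fun N => ∫ p, |g p - f N p| ∂μ) atTop (𝓝 (∫ _, (0 : ℝ) ∂μ)) := by
    refine tendsto_integral_of_dominated_convergence (fun p => |g p|)
      (fun N => (measurable_of_countable _).aestronglyMeasurable) hg.abs
      (fun N => Eventually.of_forall fun p => ?_) (Eventually.of_forall fun p => ?_)
    · simp only [hf]
      split_ifs <;> simp
    · refine tendsto_const_nhds.congr' ?_
      filter_upwards [eventually_ge_atTop ⌈|g p|⌉₊] with N hN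
      have : |g p| ≤ N := (Nat.le_ceil _).trans (by exact_mod_cast hN)
      simp [hf, this]
  rw [integral_zero] at h1
  obtain ⟨N, hN⟩ := (h1.eventually (gt_mem_nhds hδ)).exists
  refine ⟨f N, N, fun p => ?_, hN.le⟩
  simp only [hf]
  split_ifs with hp
  · exact hp
  · simp

/-- Bound `g` by `f' + c + r`: a bounded centred part handled by Chebyshev, a negative constant
drift, and a truncation error small in `L¹` handled by Markov's inequality. -/
theorem tendsto_chainLaw_pathSum_nonneg (h : κ.Invariant π) (hpos : ∀ p, (π ⊗ₘ κ) {p} ≠ 0)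
    {g : α × α → ℝ} (hg : Integrable g (π ⊗ₘ κ)) (hneg : ∫ p, g p ∂(π ⊗ₘ κ) < 0) :
    Tendsto (fun n => chainLaw π κ n {z | 0 ≤ pathSum g n z}) atTop (𝓝 0) := by
  suffices hreal : Tendsto (fun n => (chainLaw π κ n).real {z | 0 ≤ pathSum g n z}) atTop (𝓝 0) by
    have := ENNReal.tendsto_ofReal hreal
    simpa [Measure.real, ENNReal.ofReal_toReal (measure_ne_top _ _)] using this
  set m := -∫ p, g p ∂(π ⊗ₘ κ) with hm
  have hm0 : 0 < m := by linarith
  rw [Metric.tendsto_atTop]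
  intro ε hε
  -- The bound `m / 2` keeps the mean of `f` at most `-m / 2`; the bound `m * ε / 8` makes Markov's
  -- inequality at level `n * (m / 4)` yield `ε / 2`.
  obtain ⟨f, C, hfC, hfg⟩ := exists_truncation_integral_le hg
    (δ := min (m / 2) (m * ε / 8)) (by positivity)
  set r : α × α → ℝ := fun p => |g p - f p| with hr
  set c := ∫ p, f p ∂(π ⊗ₘ κ) with hc
  set f' : α × α → ℝ := fun p => f p - c with hf'
  have hfi : Integrable f (π ⊗ₘ κ) := (memLp_of_bounded hfC 1).integrable le_rfl
  have hri : Integrable r (π ⊗ₘ κ) := (hg.sub hfi).abs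
  have hcm : c ≤ -m / 2 := by
    have h1 : c - ∫ p, g p ∂(π ⊗ₘ κ) ≤ ∫ p, r p ∂(π ⊗ₘ κ) := by
      rw [hc, ← integral_sub hfi hg]
      refine integral_mono (hfi.sub hg) hri fun p => ?_
      simp only [hr, abs_sub_comm (g p)]
      exact le_abs_self _
    have h2 := hfg.trans (min_le_left _ _)
    linarith
  have hf'b : ∀ p, |f' p| ≤ C + |c| := fun p =>
    (abs_sub _ _).trans (add_le_add (hfC p) le_rfl)
  have hf'0 : ∫ p, f' p ∂(π ⊗ₘ κ) = 0 := by
    rw [integral_sub hfi (integrable_const _)]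
    simp [hc]
  have hsq := tendsto_integral_pathSum_sq h hpos hf'b hf'0
  have hrsum : ∀ n, ∫ z, pathSum r n z ∂(chainLaw π κ n) = n * ∫ p, r p ∂(π ⊗ₘ κ) ∧
      Integrable (pathSum r n) (chainLaw π κ n) := by
    intro n
    have hi : ∀ k ∈ Finset.range n, Integrable (fun z => r (z k, z (k + 1))) (chainLaw π κ n) :=
      fun k hk => (measurePreserving_chainLaw_pair h
        (Finset.mem_range.1 hk)).integrable_comp_of_integrable hri
    constructor
    · simp only [pathSum]
      rw [integral_finsetSum _ hi]
      rw [Finset.sum_congr rfl fun k hk => ?_]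
      · rw [Finset.sum_const, Finset.card_range, nsmul_eq_mul]
      · have hmp := measurePreserving_chainLaw_pair h (π := π) (Finset.mem_range.1 hk)
        rw [← hmp.map_eq, integral_map hmp.measurable.aemeasurable
          (measurable_of_countable r).aestronglyMeasurable]
    · exact integrable_finsetSum _ hi
  have hev := hsq.eventually (gt_mem_nhds (show (0 : ℝ) < (m / 4) ^ 2 * (ε / 2) by positivity))
  obtain ⟨N, hN⟩ := eventually_atTop.1 (hev.and (eventually_gt_atTop 0))
  refine ⟨N, fun n hn => ?_⟩
  obtain ⟨h1, hn0⟩ := hN n hn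
  have hn' : (0 : ℝ) < n := by exact_mod_cast hn0
  rw [Real.dist_eq, sub_zero, abs_of_nonneg measureReal_nonneg]
  -- If the centred part and the error both stay below `n * (m / 4)`, the drift `-n * (m / 2)`
  -- forces a negative total.
  have hsub : {z : ℕ → α | 0 ≤ pathSum g n z} ⊆
      {z | (n * (m / 4)) ^ 2 ≤ pathSum f' n z ^ 2} ∪ {z | n * (m / 4) ≤ pathSum r n z} := by
    intro z hz
    rw [Set.mem_union]
    by_contra! hcon
    obtain ⟨ha, hb⟩ := hcon
    simp only [Set.mem_ofPred_eq, not_le] at ha hb hz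
    have hle : pathSum g n z ≤ pathSum f' n z + n * c + pathSum r n z := by
      have : (n : ℝ) * c = ∑ k ∈ Finset.range n, c := by simp
      unfold pathSum
      rw [this, ← Finset.sum_add_distrib, ← Finset.sum_add_distrib]
      refine Finset.sum_le_sum fun k _ => ?_
      simp only [hf', hr]
      have := le_abs_self (g (z k, z (k + 1)) - f (z k, z (k + 1)))
      linarith
    have h3 := (abs_lt_of_sq_lt_sq ha (by positivity))
    have h4 := (abs_lt.1 h3).2
    nlinarith
  have hP1 := mul_meas_ge_le_integral_of_nonneg (μ := chainLaw π κ n)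
    (f := fun z => pathSum f' n z ^ 2) (Eventually.of_forall fun z => sq_nonneg _)
    (Integrable.of_bound ((measurable_pathSum f' n).pow_const 2).aestronglyMeasurable
      ((n * (C + |c|)) ^ 2) (Eventually.of_forall fun z => by
        rw [Real.norm_eq_abs, abs_pow]
        exact pow_le_pow_left₀ (abs_nonneg _) (abs_pathSum_le hf'b n z) 2)) ((n * (m / 4)) ^ 2)
  have hP2 := mul_meas_ge_le_integral_of_nonneg (μ := chainLaw π κ n)
    (f := pathSum r n) (Eventually.of_forall fun z => Finset.sum_nonneg fun k _ => abs_nonneg _)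
    (hrsum n).2 (n * (m / 4))
  rw [(hrsum n).1] at hP2
  have hP1' : (chainLaw π κ n).real {z | (n * (m / 4)) ^ 2 ≤ pathSum f' n z ^ 2} < ε / 2 := by
    rw [div_lt_iff₀ (by positivity)] at h1
    have hpp : 0 < (n * (m / 4)) ^ 2 := by positivity
    refine lt_of_mul_lt_mul_left (hP1.trans_lt (h1.trans_le (le_of_eq ?_))) hpp.le
    ring
  have hP2' : (chainLaw π κ n).real {z | n * (m / 4) ≤ pathSum r n z} ≤ ε / 2 := by
    have hpp : 0 < n * (m / 4) := by positivity
    refine le_of_mul_le_mul_left (hP2.trans ?_) hpp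
    have h2 := hfg.trans (min_le_right _ _)
    calc n * ∫ p, r p ∂(π ⊗ₘ κ) ≤ n * (m * ε / 8) := by gcongr
      _ = n * (m / 4) * (ε / 2) := by ring
  calc _ ≤ _ := measureReal_mono hsub
    _ ≤ _ := measureReal_union_le _ _
    _ < ε := by linarith

end LawOfLargeNumbers

/-! ### The walk in a fixed environment: left-step profiles and hitting of every positive level. -/

section Quenched

/-- The transition kernel of the walk in the environment `ω`. -/
def walkKernel (ω : Env) : Kernel ℤ ℤ := ⟨stepLaw ω, measurable_of_countable _⟩

instance (ω : Env) : IsMarkovKernel (walkKernel ω) :=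
  ⟨fun x => inferInstanceAs (IsProbabilityMeasure (stepLaw ω x))⟩

theorem lintegral_stepLaw (ω : Env) (x : ℤ) (g : ℤ → ℝ≥0∞) :
    ∫⁻ v, g v ∂(stepLaw ω x) =
      ENNReal.ofReal (ω x : ℝ) * g (x + 1) + ENNReal.ofReal (1 - (ω x : ℝ)) * g (x - 1) := by
  simp [stepLaw]

/-- `g` depends on the coordinates up to time `n` only. -/
def DependsUpTo {β : Type*} (n : ℕ) (g : (ℕ → ℤ) → β) : Prop :=
  ∀ X Y : ℕ → ℤ, (∀ i ≤ n, X i = Y i) → g X = g Y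

/-- The path that agrees with `y` up to time `n` and vanishes afterwards. -/
def extendPath (n : ℕ) (y : Finset.Iic n → ℤ) (i : ℕ) : ℤ :=
  if h : i ∈ Finset.Iic n then y ⟨i, h⟩ else 0

theorem extendPath_apply {n : ℕ} (y : Finset.Iic n → ℤ) (i : Finset.Iic n) :
    extendPath n y i = y i := by
  unfold extendPath
  rw [dif_pos i.2]

theorem DependsUpTo.eq_comp {β : Type*} {n : ℕ} {g : (ℕ → ℤ) → β} (hg : DependsUpTo n g) :
    g = fun X => g (extendPath n (Preorder.frestrictLe n X)) := by
  funext X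
  refine hg _ _ fun i hi => ?_
  exact (extendPath_apply (Preorder.frestrictLe n X) ⟨i, Finset.mem_Iic.2 hi⟩).symm

theorem DependsUpTo.measurable {β : Type*} [MeasurableSpace β] {n : ℕ} {g : (ℕ → ℤ) → β}
    (hg : DependsUpTo n g) : Measurable g := by
  rw [hg.eq_comp]
  exact (measurable_of_countable fun y => g (extendPath n y)).comp (by fun_prop)

/-- Path segments form a countable space, so agreement on atoms suffices. This makes the last-step
integration of `chainLaw` available for the walk. -/
theorem map_frestrictLe_quenchedMeasure (ω : Env) (n : ℕ) :
    (quenchedMeasure ω).map (Preorder.frestrictLe n) =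
      (chainLaw (Measure.dirac 0) (walkKernel ω) n).map (Preorder.frestrictLe n) := by
  refine Measure.ext_of_singleton fun y => ?_
  have hpre : (Preorder.frestrictLe n : (ℕ → ℤ) → Finset.Iic n → ℤ) ⁻¹' {y} =
      {X | ∀ i ≤ n, X i = extendPath n y i} := by
    ext X
    simp only [Set.mem_preimage, Set.mem_singleton_iff, Set.mem_ofPred_eq]
    constructor
    · rintro rfl i hi
      exact (extendPath_apply (Preorder.frestrictLe n X) ⟨i, Finset.mem_Iic.2 hi⟩).symm
    · intro h
      funext i
      rw [← extendPath_apply y i]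
      exact h i (Finset.mem_Iic.1 i.2)
  rw [Measure.map_apply (by fun_prop) (.singleton _), Measure.map_apply (by fun_prop)
    (.singleton _), hpre, quenchedMeasure_path, chainLaw_cylinder]
  congr 1
  rw [Measure.dirac_apply' _ (.singleton _)]
  simp [Set.indicator, eq_comm]

theorem lintegral_quenchedMeasure_eq (ω : Env) {n : ℕ} {g : (ℕ → ℤ) → ℝ≥0∞}
    (hg : DependsUpTo n g) :
    ∫⁻ X, g X ∂(quenchedMeasure ω) =
      ∫⁻ X, g X ∂(chainLaw (Measure.dirac 0) (walkKernel ω) n) := by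
  have hm : Measurable fun y => g (extendPath n y) := measurable_of_countable _
  rw [hg.eq_comp, ← lintegral_map hm (by fun_prop : Measurable (Preorder.frestrictLe n)),
    map_frestrictLe_quenchedMeasure, lintegral_map hm (by fun_prop)]

/-- The Markov property at time `n`, for nonnegative functionals of the first `n + 1` steps. -/
theorem lintegral_quenchedMeasure_succ (ω : Env) {n : ℕ} {g : (ℕ → ℤ) → ℝ≥0∞}
    (hg : DependsUpTo (n + 1) g) :
    ∫⁻ X, g X ∂(quenchedMeasure ω) = ∫⁻ X,
      (ENNReal.ofReal (ω (X n) : ℝ) * g (Function.update X (n + 1) (X n + 1)) +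
        ENNReal.ofReal (1 - (ω (X n) : ℝ)) * g (Function.update X (n + 1) (X n - 1)))
        ∂(quenchedMeasure ω) := by
  rw [lintegral_quenchedMeasure_eq ω hg, lintegral_chainLaw_succ hg.measurable]
  have h1 : ∀ z : ℕ → ℤ, ∫⁻ v, g (Function.update z (n + 1) v) ∂(walkKernel ω (z n)) =
      ENNReal.ofReal (ω (z n) : ℝ) * g (Function.update z (n + 1) (z n + 1)) +
        ENNReal.ofReal (1 - (ω (z n) : ℝ)) * g (Function.update z (n + 1) (z n - 1)) :=
    fun z => lintegral_stepLaw ω (z n) fun v => g (Function.update z (n + 1) v)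
  simp_rw [h1]
  refine (lintegral_quenchedMeasure_eq ω fun X Y hXY => ?_).symm
  have hn := hXY n le_rfl
  rw [hn]
  have h2 : ∀ v, g (Function.update X (n + 1) v) = g (Function.update Y (n + 1) v) := by
    intro v
    refine hg _ _ fun i hi => ?_
    rcases Nat.le_succ_iff.1 hi with h3 | rfl
    · rw [Function.update_of_ne (by omega), Function.update_of_ne (by omega), hXY i h3]
    · simp
  rw [h2, h2]

theorem ae_start (ω : Env) : ∀ᵐ X ∂(quenchedMeasure ω), X 0 = 0 := by
  have h := quenchedMeasure_path ω (fun _ => 0) 0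
  simp only [Nat.le_zero_eq, forall_eq, if_true, Finset.range_zero, Finset.prod_empty,
    mul_one] at h
  exact (mem_ae_iff_prob_eq_one₀ ((measurable_pi_apply 0 (.singleton 0)).nullMeasurableSet)).2 h

theorem ae_step_le (ω : Env) : ∀ᵐ X ∂(quenchedMeasure ω), ∀ t, X (t + 1) ≤ X t + 1 := by
  rw [ae_all_iff]
  intro t
  have hm : MeasurableSet {X : ℕ → ℤ | ¬ X (t + 1) ≤ X t + 1} :=
    (measurableSet_le (measurable_pi_apply (t + 1)) ((measurable_pi_apply t).add_const 1)).compl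
  rw [ae_iff, ← lintegral_indicator_one hm, lintegral_quenchedMeasure_succ ω (n := t)]
  · refine (lintegral_congr fun X => ?_).trans lintegral_zero
    rw [Set.indicator_of_notMem, Set.indicator_of_notMem] <;> simp
    omega
  · intro X Y h
    simp [Set.indicator, h t (by omega), h (t + 1) le_rfl]

/-- Number of left steps from `x` before time `t`. -/
def leftCount (X : ℕ → ℤ) (t x : ℕ) : ℕ :=
  ∑ s ∈ Finset.range t, if X s = (x : ℤ) ∧ X (s + 1) = (x : ℤ) - 1 then 1 else 0

theorem leftCount_congr {X Y : ℕ → ℤ} {t : ℕ} (h : ∀ i ≤ t, X i = Y i) (x : ℕ) :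
    leftCount X t x = leftCount Y t x := by
  refine Finset.sum_congr rfl fun s hs => ?_
  have := Finset.mem_range.1 hs
  rw [h s (by omega), h (s + 1) (by omega)]

theorem leftCount_update (X : ℕ → ℤ) (t x : ℕ) (v : ℤ) :
    leftCount (Function.update X (t + 1) v) (t + 1) x =
      leftCount X t x + if X t = (x : ℤ) ∧ v = (x : ℤ) - 1 then 1 else 0 := by
  unfold leftCount
  rw [Finset.sum_range_succ]
  congr 1
  · refine Finset.sum_congr rfl fun s hs => ?_
    have := Finset.mem_range.1 hs
    rw [Function.update_of_ne (by omega), Function.update_of_ne (by omega)]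
  · simp

/-- The probability, for a walk now at `x` that is certain to return from the negative
half-line, to reach `n` with exactly `r y` further left steps from each `y ≤ n`. -/
def profileWeight (p q : ℤ → ℝ≥0∞) (n : ℕ) (x : ℤ) (r : ℕ → ℕ) : ℝ≥0∞ :=
  ∏ y ∈ Finset.range n,
    ((r (y + 1) + if x ≤ (y : ℤ) then 1 else 0).multichoose (r y) : ℝ≥0∞) *
      p y ^ (r (y + 1) + if x ≤ (y : ℤ) then 1 else 0) * q y ^ r y

theorem profileWeight_neg (p q : ℤ → ℝ≥0∞) (n : ℕ) {x : ℤ} (hx : x ≤ 0) (r : ℕ → ℕ) :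
    profileWeight p q n x r = profileWeight p q n 0 r := by
  refine Finset.prod_congr rfl fun y _ => ?_
  rw [if_pos (show x ≤ (y : ℤ) by omega), if_pos (show (0 : ℤ) ≤ (y : ℤ) by omega)]

theorem profileWeight_end (p q : ℤ → ℝ≥0∞) (n : ℕ) {r : ℕ → ℕ} (hr : ∀ y ≤ n, r y = 0) :
    profileWeight p q n n r = 1 := by
  refine Finset.prod_eq_one fun y hy => ?_
  have := Finset.mem_range.1 hy
  rw [if_neg (by omega), hr y (by omega), hr (y + 1) (by omega)]
  simp

/-- Pascal's rule for the moves at one site: `b` left moves are interleaved with `a + 1` right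
moves, the last move being to the right, and the first move is either a right or a left one. -/
theorem multichoose_step (p q : ℝ≥0∞) (a b : ℕ) :
    ((a + 1).multichoose b : ℝ≥0∞) * p ^ (a + 1) * q ^ b =
      p * ((a.multichoose b : ℝ≥0∞) * p ^ a * q ^ b) +
        q * (if b = 0 then 0 else
          ((a + 1).multichoose (b - 1) : ℝ≥0∞) * p ^ (a + 1) * q ^ (b - 1)) := by
  cases b with
  | zero => simp [pow_succ, mul_comm]
  | succ b =>
    rw [Nat.multichoose_succ_succ, if_neg (by omega), Nat.add_sub_cancel]
    push_cast
    ring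

/-- First-step analysis at `k`. A right step removes the pending upward crossing of `k`. A left step
uses up one left move at `k` and creates a pending crossing of `k - 1`; these two changes cancel in
the exponent at site `k - 1`. -/
theorem profileWeight_step (p q : ℤ → ℝ≥0∞) {n k : ℕ} (hk : k < n) (r : ℕ → ℕ) :
    profileWeight p q n k r = p k * profileWeight p q n (k + 1) r +
      q k * (if r k = 0 then 0 else
        profileWeight p q n (k - 1) (Function.update r k (r k - 1))) := by
  have hmem : k ∈ Finset.range n := Finset.mem_range.2 hk
  have hsplit : ∀ (x : ℤ) (r : ℕ → ℕ), profileWeight p q n x r =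
      (((r (k + 1) + if x ≤ (k : ℤ) then 1 else 0).multichoose (r k) : ℝ≥0∞) *
        p k ^ (r (k + 1) + if x ≤ (k : ℤ) then 1 else 0) * q k ^ r k) *
      ∏ y ∈ (Finset.range n).erase k,
        ((r (y + 1) + if x ≤ (y : ℤ) then 1 else 0).multichoose (r y) : ℝ≥0∞) *
          p y ^ (r (y + 1) + if x ≤ (y : ℤ) then 1 else 0) * q y ^ r y :=
    fun x r => (Finset.mul_prod_erase _ _ hmem).symm
  have e1 : ¬ ((k : ℤ) + 1 ≤ k) := by omega
  have e2 : (k : ℤ) - 1 ≤ k := by omega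
  rw [hsplit k, hsplit (k + 1), hsplit (k - 1), if_pos le_rfl, if_neg e1, if_pos e2,
    multichoose_step, add_mul]
  congr 1
  · rw [add_zero, mul_assoc]
    congr 2
    refine Finset.prod_congr rfl fun y hy => ?_
    have hne := Finset.ne_of_mem_erase hy
    have : ((k : ℤ) ≤ y) ↔ ((k : ℤ) + 1 ≤ y) := by omega
    simp only [this]
  · rw [mul_assoc]
    congr 1
    split_ifs with h0
    · simp
    · congr 1
      · rw [Function.update_of_ne (by omega), Function.update_self]
      · refine Finset.prod_congr rfl fun y hy => ?_
        have hne := Finset.ne_of_mem_erase hy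
        rw [Function.update_of_ne hne]
        have key : (Function.update r k (r k - 1) (y + 1) +
            if (k : ℤ) - 1 ≤ (y : ℤ) then 1 else 0) =
            r (y + 1) + if (k : ℤ) ≤ (y : ℤ) then 1 else 0 := by
          by_cases hy1 : y + 1 = k
          · rw [hy1, Function.update_self, if_pos (by omega), if_neg (by omega)]
            omega
          · rw [Function.update_of_ne hy1]
            congr 1
            have : ((k : ℤ) - 1 ≤ y) ↔ ((k : ℤ) ≤ y) := by omega
            simp only [this]
        rw [key]

open Classical in
/-- The conditional probability given the path up to time `t` that the left-step counts up to
the first visit of `n` are given by `c`. -/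
def profileMartingale (p q : ℤ → ℝ≥0∞) (n : ℕ) (c : ℕ → ℕ) (t : ℕ) (X : ℕ → ℤ) : ℝ≥0∞ :=
  if (∀ s < t, X s < n) ∧ X t ≤ n ∧ (∀ x ≤ n, leftCount X t x ≤ c x) then
    profileWeight p q n (X t) (fun x => c x - leftCount X t x) else 0

theorem dependsUpTo_profileMartingale (p q : ℤ → ℝ≥0∞) (n : ℕ) (c : ℕ → ℕ) (t : ℕ) :
    DependsUpTo t (profileMartingale p q n c t) := by
  intro X Y h
  have h1 : (∀ s < t, X s < n) ↔ ∀ s < t, Y s < n :=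
    forall₂_congr fun s hs => by rw [h s hs.le]
  unfold profileMartingale
  simp only [h1, h t le_rfl, leftCount_congr h]

theorem forall_lt_update_iff (X : ℕ → ℤ) (t : ℕ) (v b : ℤ) :
    (∀ s < t + 1, Function.update X (t + 1) v s < b) ↔ (∀ s < t, X s < b) ∧ X t < b := by
  constructor
  · intro h
    refine ⟨fun s hs => ?_, ?_⟩
    · have := h s (by omega)
      rwa [Function.update_of_ne (by omega)] at this
    · have := h t (by omega)
      rwa [Function.update_of_ne (by omega)] at this
  · rintro ⟨h1, h2⟩ s hs
    rw [Function.update_of_ne (by omega)]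
    rcases Nat.lt_succ_iff_lt_or_eq.1 hs with h3 | rfl
    · exact h1 s h3
    · exact h2

/-- On the negative half-line the weight is independent of the position and `p + q = 1` suffices; at
the sites `0 ≤ k < n` the claim is `profileWeight_step`. Once `n` is reached the next value is `0`,
and the third summand retains the mass that stops there. -/
theorem profileMartingale_step (p q : ℤ → ℝ≥0∞) (hpq : ∀ x, p x + q x = 1) (n : ℕ) (c : ℕ → ℕ)
    (t : ℕ) (X : ℕ → ℤ) :
    p (X t) * profileMartingale p q n c (t + 1) (Function.update X (t + 1) (X t + 1)) +
      q (X t) * profileMartingale p q n c (t + 1) (Function.update X (t + 1) (X t - 1)) +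
      (if X t = n then profileMartingale p q n c t X else 0) ≤ profileMartingale p q n c t X := by
  set F := profileMartingale p q n c with hF
  by_cases halive : (∀ s < t, X s < n) ∧ X t < n
  swap
  · have h0 : ∀ v, F (t + 1) (Function.update X (t + 1) v) = 0 := by
      intro v
      rw [hF, profileMartingale, if_neg]
      rw [forall_lt_update_iff]
      tauto
    rw [h0, h0]
    simp only [mul_zero, zero_add]
    split_ifs <;> simp
  rw [if_neg (by have := halive.2; omega), add_zero]
  by_cases hfit : ∀ x ≤ n, leftCount X t x ≤ c x
  swap
  · have h0 : ∀ v, F (t + 1) (Function.update X (t + 1) v) = 0 := by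
      intro v
      rw [hF, profileMartingale, if_neg]
      rintro ⟨-, -, h⟩
      refine hfit fun x hx => ?_
      have := h x hx
      rw [leftCount_update] at this
      omega
    rw [h0, h0]
    simp
  set r : ℕ → ℕ := fun x => c x - leftCount X t x with hr
  have hX : F t X = profileWeight p q n (X t) r := by
    rw [hF, profileMartingale, if_pos ⟨halive.1, halive.2.le, hfit⟩]
  have hup : F (t + 1) (Function.update X (t + 1) (X t + 1)) =
      profileWeight p q n (X t + 1) r := by
    have hcount : ∀ x, leftCount (Function.update X (t + 1) (X t + 1)) (t + 1) x =
        leftCount X t x := by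
      intro x
      rw [leftCount_update, if_neg (by omega), add_zero]
    rw [hF, profileMartingale, if_pos]
    · simp only [Function.update_self, hcount, hr]
    · refine ⟨(forall_lt_update_iff _ _ _ _).2 halive, ?_, fun x hx => ?_⟩
      · rw [Function.update_self]
        have := halive.2
        omega
      · rw [hcount]
        exact hfit x hx
  rw [hX, hup]
  rcases lt_or_ge (X t) 0 with hneg | hnn
  · have hcount : ∀ x, leftCount (Function.update X (t + 1) (X t - 1)) (t + 1) x =
        leftCount X t x := by
      intro x
      rw [leftCount_update, if_neg (by omega), add_zero]
    have hdown : F (t + 1) (Function.update X (t + 1) (X t - 1)) =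
        profileWeight p q n (X t - 1) r := by
      rw [hF, profileMartingale, if_pos]
      · simp only [Function.update_self, hcount, hr]
      · refine ⟨(forall_lt_update_iff _ _ _ _).2 halive, ?_, fun x hx => ?_⟩
        · rw [Function.update_self]
          omega
        · rw [hcount]
          exact hfit x hx
    rw [hdown, profileWeight_neg p q n (x := X t + 1) (by omega),
      profileWeight_neg p q n (x := X t - 1) (by omega),
      profileWeight_neg p q n (x := X t) hneg.le, ← add_mul, hpq, one_mul]
  · obtain ⟨k, hk⟩ := Int.eq_ofNat_of_zero_le hnn
    have hkn : k < n := by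
      have := halive.2
      omega
    have hcount : ∀ x, leftCount (Function.update X (t + 1) (X t - 1)) (t + 1) x =
        leftCount X t x + if x = k then 1 else 0 := by
      intro x
      rw [leftCount_update]
      congr 1
      by_cases hxk : x = k
      · rw [if_pos hxk, if_pos ⟨by omega, by omega⟩]
      · rw [if_neg hxk, if_neg (by omega)]
    have hdown : F (t + 1) (Function.update X (t + 1) (X t - 1)) ≤
        if r k = 0 then 0 else
          profileWeight p q n (k - 1) (Function.update r k (r k - 1)) := by
      rw [hF, profileMartingale]
      split_ifs with h1 h2
      · have := h1.2.2 k hkn.le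
        rw [hcount, if_pos rfl] at this
        simp only [hr] at h2
        omega
      · refine le_of_eq ?_
        rw [Function.update_self, hk]
        congr 1
        funext x
        have h3 := hcount x
        rw [hk] at h3
        rw [h3]
        by_cases hxk : x = k
        · subst hxk
          rw [if_pos rfl, Function.update_self]
          simp only [hr]
          omega
        · rw [if_neg hxk, Function.update_of_ne hxk]
          rfl
      · exact le_rfl
      · exact zero_le
    calc _ ≤ p k * profileWeight p q n (k + 1) r + q k * (if r k = 0 then 0 else
          profileWeight p q n (k - 1) (Function.update r k (r k - 1))) := by
            rw [hk] at hdown ⊢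
            gcongr
      _ = _ := by rw [hk]; exact (profileWeight_step p q hkn r).symm

/-- The walk first visits `n` at time `t`, from the left, with left-step counts `c`. -/
def firstVisitProfile (n : ℕ) (c : ℕ → ℕ) (t : ℕ) : Set (ℕ → ℤ) :=
  {X | (∀ s < t, X s < n) ∧ X t = n ∧ ∀ x ≤ n, leftCount X t x = c x}

theorem dependsUpTo_firstVisitProfile (n : ℕ) (c : ℕ → ℕ) (t : ℕ) :
    DependsUpTo t (fun X => X ∈ firstVisitProfile n c t) := by
  intro X Y h
  have h1 : (∀ s < t, X s < n) ↔ ∀ s < t, Y s < n :=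
    forall₂_congr fun s hs => by rw [h s hs.le]
  simp only [firstVisitProfile, Set.mem_ofPred_eq, h1, h t le_rfl, leftCount_congr h]

theorem measurableSet_firstVisitProfile (n : ℕ) (c : ℕ → ℕ) (t : ℕ) :
    MeasurableSet (firstVisitProfile n c t) :=
  measurableSet_setOfPred.2 (dependsUpTo_firstVisitProfile n c t).measurable

/-- The probability of stepping right in the environment `ω`. -/
def rightProb (ω : Env) (x : ℤ) : ℝ≥0∞ := ENNReal.ofReal (ω x : ℝ)

/-- The probability of stepping left in the environment `ω`. -/
def leftProb (ω : Env) (x : ℤ) : ℝ≥0∞ := ENNReal.ofReal (1 - (ω x : ℝ))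

theorem rightProb_add_leftProb (ω : Env) (x : ℤ) : rightProb ω x + leftProb ω x = 1 := by
  have h := (ω x).2
  rw [rightProb, leftProb, ← ENNReal.ofReal_add h.1.le (by linarith [h.2])]
  simp

/-- The supermartingale inequality telescopes: the mass deposited at first visits plus the remaining
expectation never exceeds the initial value. -/
theorem sum_firstVisitProfile_le (ω : Env) (n : ℕ) (c : ℕ → ℕ) (N : ℕ) :
    ∑ t ∈ Finset.range N, quenchedMeasure ω (firstVisitProfile n c t) +
        ∫⁻ X, profileMartingale (rightProb ω) (leftProb ω) n c N X ∂(quenchedMeasure ω) ≤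
      profileWeight (rightProb ω) (leftProb ω) n 0 c := by
  set F := profileMartingale (rightProb ω) (leftProb ω) n c with hF
  induction N with
  | zero =>
    rw [Finset.range_zero, Finset.sum_empty, zero_add]
    have : ∀ᵐ X ∂(quenchedMeasure ω), F 0 X ≤
        profileWeight (rightProb ω) (leftProb ω) n 0 c := by
      filter_upwards [ae_start ω] with X hX
      rw [hF, profileMartingale]
      split_ifs
      · simp [hX, leftCount]
      · exact zero_le
    refine (lintegral_mono_ae this).trans ?_
    simp
  | succ N ih =>
    refine le_trans ?_ ih
    rw [Finset.sum_range_succ, add_assoc]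
    gcongr
    have hFm : ∀ t, Measurable (F t) := fun t =>
      (dependsUpTo_profileMartingale _ _ n c t).measurable
    -- When `n` is reached with exactly the prescribed counts, no left steps remain and the weight
    -- equals `1`.
    have hlast : quenchedMeasure ω (firstVisitProfile n c N) ≤
        ∫⁻ X, (if X N = n then F N X else 0) ∂(quenchedMeasure ω) := by
      rw [← lintegral_indicator_one (measurableSet_firstVisitProfile n c N)]
      refine lintegral_mono fun X => ?_
      by_cases hX : X ∈ firstVisitProfile n c N
      · rw [Set.indicator_of_mem hX, if_pos hX.2.1, hF, profileMartingale,
          if_pos ⟨hX.1, hX.2.1.le, fun x hx => (hX.2.2 x hx).le⟩, hX.2.1, profileWeight_end]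
        · rfl
        · intro y hy
          rw [hX.2.2 y hy, Nat.sub_self]
      · rw [Set.indicator_of_notMem hX]
        exact zero_le
    refine (add_le_add_left hlast _).trans ?_
    have hdep := dependsUpTo_profileMartingale (rightProb ω) (leftProb ω) n c
    rw [lintegral_quenchedMeasure_succ ω (hdep (N + 1)), add_comm, ← lintegral_add_right]
    · exact lintegral_mono fun X =>
        profileMartingale_step (rightProb ω) (leftProb ω) (rightProb_add_leftProb ω) n c N X
    · refine Measurable.ite ?_ (hFm N) measurable_const
      exact (measurable_pi_apply N : Measurable fun X : ℕ → ℤ => X N) (.singleton (n : ℤ))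

theorem quenchedMeasure_firstVisitProfile_le (ω : Env) (n : ℕ) (c : ℕ → ℕ) :
    quenchedMeasure ω (⋃ t, firstVisitProfile n c t) ≤
      profileWeight (rightProb ω) (leftProb ω) n 0 c := by
  refine (measure_iUnion_le _).trans (ENNReal.tsum_le_of_sum_range_le fun N => ?_)
  exact le_self_add.trans (sum_firstVisitProfile_le ω n c N)

/-- Upward steps have size at most one, so the level `n` cannot be jumped over. -/
theorem lt_of_lt_hittingTime {X : ℕ → ℤ} {n : ℕ} (h0 : X 0 = 0) (hstep : ∀ t, X (t + 1) ≤ X t + 1)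
    {s : ℕ} (hs : s < hittingTime X n) : X s < n := by
  have hne : ∀ s < hittingTime X n, X s ≠ n := fun s hs => Nat.notMem_of_lt_sInf hs
  induction s with
  | zero =>
    have := hne 0 hs
    omega
  | succ s ih =>
    have h1 := ih (by omega)
    have h2 := hstep s
    have h3 := hne (s + 1) hs
    omega

theorem mem_firstVisitProfile {X : ℕ → ℤ} {n : ℕ} {c : ℕ → ℕ} (h0 : X 0 = 0)
    (hstep : ∀ t, X (t + 1) ≤ X t + 1) (hit : ∃ t, X t = n)
    (hc : ∀ x ≤ n, leftSteps X n x = c x) :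
    X ∈ firstVisitProfile n c (hittingTime X n) :=
  ⟨fun _ hs => lt_of_lt_hittingTime h0 hstep hs, Nat.sInf_mem (s := {t | X t = (n : ℤ)}) hit, hc⟩

theorem leftSteps_self (X : ℕ → ℤ) (n : ℕ) : leftSteps X n n = 0 := by
  refine Finset.sum_eq_zero fun s hs => if_neg fun h => ?_
  exact Nat.notMem_of_lt_sInf (s := {t | X t = (n : ℤ)}) (Finset.mem_range.1 hs) h.1

/-- The probability, started from `x`, that the walk stays below `n` up to time `t`. -/
def stayBelow (ω : Env) (n : ℤ) : ℕ → ℤ → ℝ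
  | 0, x => if x < n then 1 else 0
  | t + 1, x => if x < n then
      (ω x : ℝ) * stayBelow ω n t (x + 1) + (1 - (ω x : ℝ)) * stayBelow ω n t (x - 1) else 0

theorem stayBelow_mem (ω : Env) (n : ℤ) (t : ℕ) (x : ℤ) :
    0 ≤ stayBelow ω n t x ∧ stayBelow ω n t x ≤ 1 := by
  induction t generalizing x with
  | zero => unfold stayBelow; split_ifs <;> simp
  | succ t ih =>
    have h := (ω x).2
    unfold stayBelow
    split_ifs
    · have h1 := ih (x + 1)
      have h2 := ih (x - 1)
      constructor
      · nlinarith [h.1, h.2, mul_nonneg h.1.le h1.1, mul_nonneg (sub_nonneg.2 h.2.le) h2.1]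
      · nlinarith [h.1, h.2, mul_nonneg h.1.le (sub_nonneg.2 h1.2),
          mul_nonneg (sub_nonneg.2 h.2.le) (sub_nonneg.2 h2.2)]
    · simp

theorem stayBelow_of_ge (ω : Env) {n x : ℤ} (hx : n ≤ x) (t : ℕ) : stayBelow ω n t x = 0 := by
  cases t <;> (unfold stayBelow; rw [if_neg (by omega)])

theorem stayBelow_succ_le (ω : Env) (n : ℤ) (t : ℕ) (x : ℤ) :
    stayBelow ω n (t + 1) x ≤ stayBelow ω n t x := by
  induction t generalizing x with
  | zero =>
    by_cases hx : x < n
    · have := (stayBelow_mem ω n 1 x).2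
      rwa [show stayBelow ω n 0 x = 1 by rw [stayBelow, if_pos hx]]
    · rw [stayBelow_of_ge ω (not_lt.1 hx), stayBelow_of_ge ω (not_lt.1 hx)]
  | succ t ih =>
    have h := (ω x).2
    by_cases hx : x < n
    · have e : ∀ t, stayBelow ω n (t + 1) x = (ω x : ℝ) * stayBelow ω n t (x + 1) +
          (1 - (ω x : ℝ)) * stayBelow ω n t (x - 1) := fun t => by rw [stayBelow, if_pos hx]
      rw [e (t + 1), e t]
      exact add_le_add (mul_le_mul_of_nonneg_left (ih _) h.1.le)
        (mul_le_mul_of_nonneg_left (ih _) (sub_nonneg.2 h.2.le))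
    · rw [stayBelow_of_ge ω (not_lt.1 hx), stayBelow_of_ge ω (not_lt.1 hx)]

/-- Harmonicity multiplies successive increments by `1 / ρ`, so `v (n - 1)` is a product of `ρ`'s
times a difference of values in `[0, 1]`. If the products vanish in the limit, so does `v (n - 1)`,
and then every increment. -/
theorem harmonic_eq_zero {ω : Env} {n : ℤ} {v : ℤ → ℝ} (hb : ∀ x, 0 ≤ v x ∧ v x ≤ 1)
    (hn : v n = 0)
    (hharm : ∀ x < n, v x = (ω x : ℝ) * v (x + 1) + (1 - (ω x : ℝ)) * v (x - 1))
    (hρ : Tendsto (fun k : ℕ => ∏ i ∈ Finset.range k, rho ω (n - 1 - i)) atTop (𝓝 0)) :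
    ∀ k : ℕ, v (n - k) = 0 := by
  have hD : ∀ k : ℕ, v (n - 1) =
      (∏ i ∈ Finset.range k, rho ω (n - 1 - i)) * (v (n - k - 1) - v (n - k)) := by
    intro k
    induction k with
    | zero => simp [hn]
    | succ k ih =>
      rw [ih, Finset.prod_range_succ, mul_assoc]
      congr 1
      have h1 := hharm (n - 1 - k) (by omega)
      have hω := (ω (n - 1 - k)).2
      have e1 : n - 1 - (k : ℤ) + 1 = n - k := by ring
      have e2 : n - ((k + 1 : ℕ) : ℤ) = n - 1 - k := by push_cast; ring
      have e3 : n - (k : ℤ) - 1 = n - 1 - k := by ring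
      rw [e1] at h1
      rw [e2, e3, rho]
      field_simp [hω.1.ne']
      linarith
  have hρ0 : ∀ x, 0 < rho ω x := fun x => div_pos (sub_pos.2 (ω x).2.2) (ω x).2.1
  have hv : v (n - 1) = 0 := by
    refine le_antisymm (ge_of_tendsto' hρ fun k => ?_) (hb _).1
    rw [hD k]
    have h1 : 0 ≤ ∏ i ∈ Finset.range k, rho ω (n - 1 - i) :=
      Finset.prod_nonneg fun i _ => (hρ0 _).le
    have h2 := (hb (n - k - 1)).2
    have h3 := (hb (n - k)).1
    nlinarith
  intro k
  induction k with
  | zero => simpa using hn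
  | succ k ih =>
    have h1 := hD k
    rw [hv, ih, sub_zero, eq_comm, mul_eq_zero] at h1
    rcases h1 with h1 | h1
    · exact absurd h1 (Finset.prod_ne_zero_iff.2 fun i _ => (hρ0 _).ne')
    · rw [← h1]
      congr 1
      push_cast
      ring

/-- The decreasing limit over time is bounded, harmonic below `n` and zero at `n`, so
`harmonic_eq_zero` applies. -/
theorem tendsto_stayBelow {ω : Env} {n : ℤ}
    (hρ : Tendsto (fun k : ℕ => ∏ i ∈ Finset.range k, rho ω (n - 1 - i)) atTop (𝓝 0)) (k : ℕ) :
    Tendsto (fun t => stayBelow ω n t (n - k)) atTop (𝓝 0) := by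
  set v : ℤ → ℝ := fun x => ⨅ t, stayBelow ω n t x with hv
  have hlim : ∀ x, Tendsto (fun t => stayBelow ω n t x) atTop (𝓝 (v x)) := fun x =>
    tendsto_atTop_ciInf (antitone_nat_of_succ_le fun t => stayBelow_succ_le ω n t x)
      ⟨0, by rintro _ ⟨t, rfl⟩; exact (stayBelow_mem ω n t x).1⟩
  have hb : ∀ x, 0 ≤ v x ∧ v x ≤ 1 := fun x =>
    ⟨ge_of_tendsto' (hlim x) fun t => (stayBelow_mem ω n t x).1,
      le_of_tendsto' (hlim x) fun t => (stayBelow_mem ω n t x).2⟩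
  have hn : v n = 0 := by simp [hv, stayBelow_of_ge ω le_rfl]
  have hharm : ∀ x < n, v x = (ω x : ℝ) * v (x + 1) + (1 - (ω x : ℝ)) * v (x - 1) := by
    intro x hx
    refine tendsto_nhds_unique ((hlim x).comp (tendsto_add_atTop_nat 1)) ?_
    have := ((hlim (x + 1)).const_mul (ω x : ℝ)).add ((hlim (x - 1)).const_mul (1 - (ω x : ℝ)))
    refine this.congr fun t => ?_
    simp only [Function.comp, stayBelow, if_pos hx]
  have := hlim (n - k)
  rwa [harmonic_eq_zero hb hn hharm hρ k] at this

/-- The Markov property trades one observed step for one step of the recursion; `t = 0` bounds the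
probability of staying below `n`. -/
theorem lintegral_stayBelow_le (ω : Env) (n : ℤ) (s t : ℕ) :
    ∫⁻ X, (if ∀ r < s, X r < n then ENNReal.ofReal (stayBelow ω n t (X s)) else 0)
      ∂(quenchedMeasure ω) ≤ ENNReal.ofReal (stayBelow ω n (s + t) 0) := by
  induction s generalizing t with
  | zero =>
    have : ∀ᵐ X : ℕ → ℤ ∂(quenchedMeasure ω),
        (if ∀ r < (0 : ℕ), X r < n then ENNReal.ofReal (stayBelow ω n t (X 0)) else 0) ≤
          ENNReal.ofReal (stayBelow ω n (0 + t) 0) := by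
      filter_upwards [ae_start ω] with X hX
      simp [hX]
    refine (lintegral_mono_ae this).trans ?_
    simp
  | succ s ih =>
    have e : s + 1 + t = s + (t + 1) := by ring
    rw [lintegral_quenchedMeasure_succ ω (n := s), e]
    · refine le_trans (lintegral_mono fun X => ?_) (ih (t + 1))
      simp only [forall_lt_update_iff, Function.update_self]
      by_cases h1 : (∀ r < s, X r < n)
      · by_cases h2 : X s < n
        · rw [if_pos ⟨h1, h2⟩, if_pos ⟨h1, h2⟩, if_pos h1, stayBelow, if_pos h2]
          have hω := (ω (X s)).2
          rw [← ENNReal.ofReal_mul hω.1.le, ← ENNReal.ofReal_mul (sub_nonneg.2 hω.2.le),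
            ← ENNReal.ofReal_add (mul_nonneg hω.1.le (stayBelow_mem _ _ _ _).1)
              (mul_nonneg (sub_nonneg.2 hω.2.le) (stayBelow_mem _ _ _ _).1)]
        · rw [if_neg (by tauto), if_neg (by tauto)]
          simp
      · rw [if_neg (by tauto), if_neg (by tauto)]
        simp
    · intro X Y h
      have h1 : (∀ r < s + 1, X r < n) ↔ ∀ r < s + 1, Y r < n :=
        forall₂_congr fun r hr => by rw [h r hr.le]
      simp only [h1, h (s + 1) le_rfl]

theorem ae_exists_hit {ω : Env}
    (hρ : ∀ n : ℤ, Tendsto (fun k : ℕ => ∏ i ∈ Finset.range k, rho ω (n - 1 - i)) atTop (𝓝 0))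
    (n : ℕ) : ∀ᵐ X ∂(quenchedMeasure ω), ∃ t, X t = (n : ℤ) := by
  have hzero : quenchedMeasure ω {X | ∀ t, X t < (n : ℤ)} = 0 := by
    have hlim : Tendsto (fun t => ENNReal.ofReal (stayBelow ω n t 0)) atTop (𝓝 0) := by
      have := ENNReal.tendsto_ofReal (tendsto_stayBelow (hρ n) n)
      simpa using this
    refine le_antisymm (ge_of_tendsto' hlim fun t => ?_) zero_le
    refine le_trans ?_ (lintegral_stayBelow_le ω n t 0)
    have hm : MeasurableSet {X : ℕ → ℤ | ∀ t, X t < n} := by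
      have : {X : ℕ → ℤ | ∀ t, X t < n} = ⋂ t, (fun X : ℕ → ℤ => X t) ⁻¹' Set.Iio (n : ℤ) := by
        ext; simp
      rw [this]
      exact MeasurableSet.iInter fun t => measurable_pi_apply t measurableSet_Iio
    rw [← lintegral_indicator_one hm]
    refine lintegral_mono fun X => ?_
    by_cases hX : ∀ t, X t < n
    · rw [Set.indicator_of_mem (s := {X : ℕ → ℤ | ∀ t, X t < n}) hX, if_pos fun r _ => hX r,
        stayBelow, if_pos (hX t)]
      simp
    · rw [Set.indicator_of_notMem (s := {X : ℕ → ℤ | ∀ t, X t < n}) hX]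
      exact zero_le
  have hae : ∀ᵐ X ∂(quenchedMeasure ω), ¬ ∀ t, X t < (n : ℤ) := by
    rw [ae_iff]
    simpa using hzero
  filter_upwards [hae, ae_start ω, ae_step_le ω] with X h1 h2 h3
  by_contra! hne
  refine h1 fun t => ?_
  induction t with
  | zero => have := hne 0; omega
  | succ t ih =>
    have := hne (t + 1)
    have := h3 t
    omega

end Quenched

/-! ### The i.i.d. environment and the random series defining `S`. -/

section Environment

variable (ν : ProbabilityMeasure (Set.Ioo (0 : ℝ) 1))

instance : IsProbabilityMeasure (envLaw ν) := by
  unfold envLaw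
  infer_instance

theorem rho_pos (ω : Env) (x : ℤ) : 0 < rho ω x := div_pos (sub_pos.2 (ω x).2.2) (ω x).2.1

theorem measurable_rho (x : ℤ) : Measurable fun ω => rho ω x := by
  unfold rho
  fun_prop

theorem map_reindex_envLaw {e : ℤ → ℤ} (he : Function.Injective e) :
    (envLaw ν).map (fun ω x => ω (e x)) = envLaw ν :=
  Measure.map_infinitePi_infinitePi_of_inj he

theorem iIndepFun_site {β : Type*} [MeasurableSpace β] {e : ℕ → ℤ} (he : Function.Injective e)
    {f : ℕ → Set.Ioo (0 : ℝ) 1 → β} (hf : ∀ i, Measurable (f i)) :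
    iIndepFun (fun i (ω : Env) => f i (ω (e i))) (envLaw ν) := by
  have h1 : iIndepFun (fun x (ω : Env) => ω x) (envLaw ν) :=
    iIndepFun_infinitePi (X := fun _ a => a) (fun _ => measurable_id)
  exact (h1.precomp he).comp (fun i => f i) hf

theorem lintegral_site (x : ℤ) {f : Set.Ioo (0 : ℝ) 1 → ℝ≥0∞} (hf : Measurable f) :
    ∫⁻ ω, f (ω x) ∂(envLaw ν) = ∫⁻ a, f a ∂(ν : Measure (Set.Ioo (0 : ℝ) 1)) :=
  (measurePreserving_eval_infinitePi
    (fun _ : ℤ => (ν : Measure (Set.Ioo (0 : ℝ) 1))) x).lintegral_comp hf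

theorem identDistrib_site {β : Type*} [MeasurableSpace β] (x y : ℤ)
    {f : Set.Ioo (0 : ℝ) 1 → β} (hf : Measurable f) :
    IdentDistrib (fun ω : Env => f (ω x)) (fun ω : Env => f (ω y)) (envLaw ν) (envLaw ν) := by
  have h : IdentDistrib (fun ω : Env => ω x) (fun ω : Env => ω y) (envLaw ν) (envLaw ν) :=
    ⟨(measurable_pi_apply x).aemeasurable, (measurable_pi_apply y).aemeasurable, by
      rw [envLaw, Measure.infinitePi_map_eval, Measure.infinitePi_map_eval]⟩
  exact h.comp hf

/-- Eventually the average of the logarithms is below `m / 2`, so the products are dominated by a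
geometric series. -/
theorem summable_prod_of_average_neg {r : ℕ → ℝ} (hr : ∀ i, 0 < r i) {m : ℝ} (hm : m < 0)
    (h : Tendsto (fun n : ℕ => (∑ i ∈ Finset.range n, Real.log (r i)) / n) atTop (𝓝 m)) :
    Summable fun k => ∏ i ∈ Finset.range k, r i := by
  have hgeom : Summable fun k : ℕ => Real.exp (m / 2) ^ k :=
    summable_geometric_of_lt_one (Real.exp_nonneg _) (Real.exp_lt_one_iff.2 (by linarith))
  refine hgeom.of_norm_bounded_eventually_nat ?_
  filter_upwards [h.eventually (gt_mem_nhds (show m < m / 2 by linarith)), eventually_gt_atTop 0]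
    with n hn hn0
  have hn' : (0 : ℝ) < n := by exact_mod_cast hn0
  rw [div_lt_iff₀ hn'] at hn
  have hpos : 0 < ∏ i ∈ Finset.range n, r i := Finset.prod_pos fun i _ => hr i
  rw [Real.norm_eq_abs, abs_of_pos hpos, ← Real.exp_log hpos, ← Real.exp_nat_mul,
    Real.log_prod (fun i _ => (hr i).ne')]
  exact Real.exp_le_exp.2 (by linarith)

variable {ν}

/-- The strong law for `log ρ` along any sequence of distinct sites. To the right it makes `S`
positive; to the left it gives the vanishing products that force the walk to reach `n`. -/
theorem TransientSubballistic.ae_summable (h : TransientSubballistic ν) {e : ℕ → ℤ}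
    (he : Function.Injective e) :
    ∀ᵐ ω ∂(envLaw ν), Summable fun k => ∏ i ∈ Finset.range k, rho ω (e i) := by
  have hf : Measurable fun a : Set.Ioo (0 : ℝ) 1 => Real.log ((1 - (a : ℝ)) / (a : ℝ)) := by
    fun_prop
  have hid : ∀ x y, IdentDistrib (fun ω : Env => Real.log (rho ω x))
      (fun ω => Real.log (rho ω y)) (envLaw ν) (envLaw ν) :=
    fun x y => identDistrib_site ν x y hf
  have hind : iIndepFun (fun i (ω : Env) => Real.log (rho ω (e i))) (envLaw ν) :=
    iIndepFun_site ν he fun _ => hf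
  have hlaw := strong_law_ae_real (fun i (ω : Env) => Real.log (rho ω (e i)))
    ((hid (e 0) 0).integrable_iff.2 h.integrable_log) (fun i j hij => hind.indepFun hij)
    (fun i => hid (e i) (e 0))
  filter_upwards [hlaw] with ω hω
  refine summable_prod_of_average_neg (fun i => rho_pos ω _) ?_ hω
  rw [(hid (e 0) 0).integral_eq]
  exact h.log_neg

theorem TransientSubballistic.ae_tendsto_left (h : TransientSubballistic ν) :
    ∀ᵐ ω ∂(envLaw ν), ∀ n : ℤ,
      Tendsto (fun k : ℕ => ∏ i ∈ Finset.range k, rho ω (n - 1 - i)) atTop (𝓝 0) := by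
  rw [ae_all_iff]
  intro n
  have he : Function.Injective fun i : ℕ => n - 1 - (i : ℤ) := fun i j hij => by
    simp only at hij
    omega
  filter_upwards [h.ae_summable he] with ω hω
  exact hω.tendsto_atTop_zero

/-- `S` with the series started at the site `0`. -/
def rightSeries (ω : Env) : ℝ := (∑' k : ℕ, ∏ i ∈ Finset.range k, rho ω (i : ℤ))⁻¹

theorem S_eq_tsum_range (ω : Env) :
    S ω = (∑' k : ℕ, ∏ i ∈ Finset.range k, rho ω ((i : ℤ) + 1))⁻¹ := by
  unfold S
  congr 2
  funext k
  rw [← Finset.Ico_add_one_right_eq_Icc, Finset.prod_Ico_eq_prod_range]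
  refine Finset.prod_congr (by simp) fun i _ => ?_
  push_cast
  rw [add_comm]

theorem S_eq_rightSeries_shift (ω : Env) : S ω = rightSeries fun x => ω (x + 1) := by
  rw [S_eq_tsum_range]
  rfl

theorem measurable_rightSeries : Measurable rightSeries := by
  -- Valid without summability: a divergent series has real `tsum` equal to `0`, and the `toReal` of
  -- `∞` is also `0`.
  have : rightSeries = fun ω => (∑' k : ℕ, ENNReal.ofReal
      (∏ i ∈ Finset.range k, rho ω (i : ℤ))).toReal⁻¹ := by
    funext ω
    rw [ENNReal.tsum_toReal_eq (fun _ => ENNReal.ofReal_ne_top), rightSeries]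
    congr 2
    funext k
    rw [ENNReal.toReal_ofReal (Finset.prod_nonneg fun i _ => (rho_pos ω _).le)]
  rw [this]
  refine (Measurable.tsum fun k => ?_).ennreal_toReal.inv
  exact (Finset.measurable_prod _ fun i _ => measurable_rho _).ennreal_ofReal

theorem measurable_S : Measurable S := by
  have : S = fun ω => rightSeries fun x => ω (x + 1) := funext S_eq_rightSeries_shift
  rw [this]
  exact measurable_rightSeries.comp (by fun_prop)

theorem rightSeries_mem (ω : Env) : 0 ≤ rightSeries ω ∧ rightSeries ω ≤ 1 := by
  have h0 : ∀ k, 0 ≤ ∏ i ∈ Finset.range k, rho ω (i : ℤ) := fun k =>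
    Finset.prod_nonneg fun i _ => (rho_pos ω _).le
  unfold rightSeries
  refine ⟨inv_nonneg.2 (tsum_nonneg h0), ?_⟩
  by_cases hs : Summable fun k => ∏ i ∈ Finset.range k, rho ω (i : ℤ)
  · refine inv_le_one_of_one_le₀ ?_
    simpa using hs.le_tsum 0 fun k _ => h0 k
  · rw [tsum_eq_zero_of_not_summable hs]
    simp

theorem S_mem (ω : Env) : 0 ≤ S ω ∧ S ω ≤ 1 := by
  rw [S_eq_rightSeries_shift]
  exact rightSeries_mem _

/-- Splitting off the first term gives `1 / rightSeries = 1 + ρ_0 / S`. The resulting formula is the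
parameter map of one generation of the count chain. -/
theorem rightSeries_eq {ω : Env}
    (hs : Summable fun k => ∏ i ∈ Finset.range k, rho ω ((i : ℤ) + 1)) :
    0 < S ω ∧ rightSeries ω = S ω * ω 0 / (1 - (1 - S ω) * ω 0) := by
  set A := ∑' k : ℕ, ∏ i ∈ Finset.range k, rho ω ((i : ℤ) + 1) with hA
  have hprod : ∀ k : ℕ, ∏ i ∈ Finset.range (k + 1), rho ω (i : ℤ) =
      rho ω 0 * ∏ i ∈ Finset.range k, rho ω ((i : ℤ) + 1) := by
    intro k
    rw [Finset.prod_range_succ', mul_comm]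
    simp
  have hA1 : 1 ≤ A := by
    simpa using hs.le_tsum 0 fun k _ => Finset.prod_nonneg fun i _ => (rho_pos ω _).le
  have hsum : Summable fun k => ∏ i ∈ Finset.range k, rho ω (i : ℤ) := by
    rw [← summable_nat_add_iff 1]
    simp only [hprod]
    exact hs.mul_left _
  have hSA : S ω = A⁻¹ := S_eq_tsum_range ω
  have hR : rightSeries ω = (1 + rho ω 0 * A)⁻¹ := by
    rw [rightSeries, hsum.tsum_eq_zero_add]
    simp only [hprod, Finset.range_zero, Finset.prod_empty]
    rw [tsum_mul_left]
  have hω := (ω 0).2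
  refine ⟨by rw [hSA]; positivity, ?_⟩
  rw [hR, hSA, rho]
  have h1 : 0 < A := by linarith
  have h2 : (ω 0 : ℝ) + (1 - ω 0) * A ≠ 0 := by
    have := mul_nonneg (sub_nonneg.2 hω.2.le) h1.le
    have := hω.1
    positivity
  have h3 : A - (A - 1) * (ω 0 : ℝ) ≠ 0 := by
    intro h; apply h2; linarith
  have h4 : 1 + (1 - (ω 0 : ℝ)) / ω 0 * A ≠ 0 := by
    have := mul_nonneg (div_nonneg (sub_nonneg.2 hω.2.le) hω.1.le) h1.le
    positivity
  have h5 := hω.1.ne'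
  have h6 : 1 - (1 - A⁻¹) * (ω 0 : ℝ) ≠ 0 := by
    have : 1 - (1 - A⁻¹) * (ω 0 : ℝ) = (A - (A - 1) * (ω 0 : ℝ)) / A := by
      field_simp
    rw [this]
    exact div_ne_zero h3 h1.ne'
  rw [inv_eq_one_div, div_eq_div_iff h4 h6]
  field_simp
  ring

theorem TransientSubballistic.ae_S (h : TransientSubballistic ν) :
    ∀ᵐ ω ∂(envLaw ν), Summable fun k => ∏ i ∈ Finset.range k, rho ω ((i : ℤ) + 1) :=
  h.ae_summable fun i j hij => by
    have : (i : ℤ) + 1 = j + 1 := hij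
    omega

theorem S_lt_one {ω : Env}
    (hs : Summable fun k => ∏ i ∈ Finset.range k, rho ω ((i : ℤ) + 1)) : S ω < 1 := by
  rw [S_eq_tsum_range]
  refine inv_lt_one_of_one_lt₀ ?_
  have h := hs.sum_le_tsum (Finset.range 2)
    fun k _ => Finset.prod_nonneg fun i _ => (rho_pos ω _).le
  have h1 := rho_pos ω 1
  simp only [Finset.sum_range_succ, Finset.prod_range_succ, Finset.range_zero, Finset.sum_empty,
    Finset.prod_empty, Nat.cast_zero, zero_add] at h
  linarith

variable (ν)

/-- Resampling the site `0` preserves the product law. This separates `ω_0` from `S`, which reads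
only the sites from `1` on. -/
theorem map_update_zero_envLaw :
    ((ν : Measure (Set.Ioo (0 : ℝ) 1)).prod (envLaw ν)).map
      (fun p => Function.update p.2 (0 : ℤ) p.1) = envLaw ν := by
  have hm : Measurable fun p : Set.Ioo (0 : ℝ) 1 × Env => Function.update p.2 (0 : ℤ) p.1 :=
    measurable_update'.comp measurable_swap
  refine Measure.eq_infinitePi _ fun s t ht => ?_
  rw [Measure.map_apply hm (.pi s.countable_toSet fun i _ => ht i)]
  by_cases h0 : (0 : ℤ) ∈ s
  · have hpre : (fun p : Set.Ioo (0 : ℝ) 1 × Env => Function.update p.2 (0 : ℤ) p.1) ⁻¹'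
        (Set.pi s t) = t 0 ×ˢ Set.pi (s.erase 0 : Finset ℤ) t := by
      ext ⟨a, ω⟩
      simp only [Set.mem_preimage, Set.mem_pi, Set.mem_prod, Finset.mem_coe, Finset.mem_erase]
      constructor
      · intro h
        refine ⟨by simpa using h 0 h0, fun i hi => ?_⟩
        simpa [Function.update_of_ne hi.1] using h i hi.2
      · rintro ⟨h1, h2⟩ i hi
        by_cases hi0 : i = 0
        · subst hi0
          simpa using h1
        · rw [Function.update_of_ne hi0]
          exact h2 i ⟨hi0, hi⟩
    rw [hpre, Measure.prod_prod, envLaw, Measure.infinitePi_pi _ (fun i _ => ht i),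
      Finset.mul_prod_erase s (fun i => (ν : Measure (Set.Ioo (0 : ℝ) 1)) (t i)) h0]
  · have hpre : (fun p : Set.Ioo (0 : ℝ) 1 × Env => Function.update p.2 (0 : ℤ) p.1) ⁻¹'
        (Set.pi s t) = Set.univ ×ˢ Set.pi s t := by
      ext ⟨a, ω⟩
      simp only [Set.mem_preimage, Set.mem_pi, Set.mem_prod, Finset.mem_coe, Set.mem_univ,
        true_and]
      refine forall₂_congr fun i hi => ?_
      rw [Function.update_of_ne (by rintro rfl; exact h0 hi)]
    rw [hpre, Measure.prod_prod, envLaw, Measure.infinitePi_pi _ (fun i _ => ht i), measure_univ,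
      one_mul]

end Environment

/-! ### The kernel `Q` and its invariant law. -/

section Stationary

/-- The measure on a discrete space with point masses `w`. -/
def weightMeasure {β : Type*} [MeasurableSpace β] (w : β → ℝ≥0∞) : Measure β :=
  Measure.count.withDensity w

theorem weightMeasure_singleton {β : Type*} [MeasurableSpace β] [MeasurableSingletonClass β]
    (w : β → ℝ≥0∞) (b : β) : weightMeasure w {b} = w b := by
  rw [weightMeasure, withDensity_apply _ (.singleton b), Measure.restrict_singleton,
    lintegral_smul_measure, lintegral_dirac]
  simp

theorem isProbabilityMeasure_weightMeasure {β : Type*} [MeasurableSpace β] [Countable β]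
    [MeasurableSingletonClass β] {w : β → ℝ≥0∞} (hw : ∑' b, w b = 1) :
    IsProbabilityMeasure (weightMeasure w) := by
  constructor
  rw [weightMeasure, withDensity_apply _ .univ, Measure.restrict_univ, lintegral_count, hw]

variable (ν : ProbabilityMeasure (Set.Ioo (0 : ℝ) 1))

theorem moment_integrand_mem (u v : ℕ) (a : Set.Ioo (0 : ℝ) 1) :
    0 < (a : ℝ) ^ (u + 1) * (1 - (a : ℝ)) ^ v ∧ (a : ℝ) ^ (u + 1) * (1 - (a : ℝ)) ^ v ≤ 1 := by
  have h := a.2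
  have h1 : 0 < 1 - (a : ℝ) := sub_pos.2 h.2
  refine ⟨by have := h.1; positivity, ?_⟩
  exact mul_le_one₀ (pow_le_one₀ h.1.le h.2.le) (by positivity)
    (pow_le_one₀ h1.le (by linarith [h.1]))

theorem integrable_moment (u v : ℕ) :
    Integrable (fun a : Set.Ioo (0 : ℝ) 1 => (a : ℝ) ^ (u + 1) * (1 - (a : ℝ)) ^ v)
      (ν : Measure (Set.Ioo (0 : ℝ) 1)) := by
  refine Integrable.of_bound (by fun_prop) 1 (Eventually.of_forall fun a => ?_)
  rw [Real.norm_eq_abs, abs_of_pos (moment_integrand_mem u v a).1]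
  exact (moment_integrand_mem u v a).2

theorem moment_pos (u v : ℕ) : 0 < moment ν u v := by
  rw [moment, integral_pos_iff_support_of_nonneg
    (fun a => (moment_integrand_mem u v a).1.le) (integrable_moment ν u v)]
  have : (Function.support fun a : Set.Ioo (0 : ℝ) 1 => (a : ℝ) ^ (u + 1) * (1 - (a : ℝ)) ^ v) =
      Set.univ := by
    ext a
    simpa using (moment_integrand_mem u v a).1.ne'
  rw [this, measure_univ]
  exact one_pos

theorem Q_pos (u v : ℕ) : 0 < Q ν u v :=
  mul_pos (by exact_mod_cast Nat.choose_pos (Nat.le_add_left v u)) (moment_pos ν u v)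

theorem ofReal_Q (u v : ℕ) : ENNReal.ofReal (Q ν u v) = ∫⁻ a, ENNReal.ofReal
    (((u + v).choose v : ℝ) * ((a : ℝ) ^ (u + 1) * (1 - (a : ℝ)) ^ v))
      ∂(ν : Measure (Set.Ioo (0 : ℝ) 1)) := by
  rw [Q, moment, ← integral_const_mul, ofReal_integral_eq_lintegral_ofReal
    ((integrable_moment ν u v).const_mul _)]
  exact Eventually.of_forall fun a =>
    mul_nonneg (Nat.cast_nonneg _) (moment_integrand_mem u v a).1.le

/-- Total mass of the negative binomial law: failures before the `(u + 1)`-st success, with success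
probability `a`. -/
theorem hasSum_negBinomial (u : ℕ) {a : ℝ} (h0 : 0 < a) (h1 : a < 1) :
    HasSum (fun v : ℕ => ((u + v).choose v : ℝ) * (a ^ (u + 1) * (1 - a) ^ v)) 1 := by
  have h := (hasSum_choose_mul_geometric_of_norm_lt_one u (r := 1 - a) (by
    rw [Real.norm_eq_abs, abs_of_pos (by linarith)]; linarith)).mul_left (a ^ (u + 1))
  have e : a ^ (u + 1) * (1 / (1 - (1 - a)) ^ (u + 1)) = 1 := by
    rw [sub_sub_cancel]
    field_simp
  rw [e] at h
  refine h.congr_fun fun v => ?_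
  rw [← Nat.choose_symm_add, add_comm u v]
  ring

theorem tsum_ofReal_Q (u : ℕ) : ∑' v, ENNReal.ofReal (Q ν u v) = 1 := by
  simp_rw [ofReal_Q]
  rw [← lintegral_tsum fun v => by fun_prop]
  have : ∀ a : Set.Ioo (0 : ℝ) 1, ∑' v : ℕ, ENNReal.ofReal
      (((u + v).choose v : ℝ) * ((a : ℝ) ^ (u + 1) * (1 - (a : ℝ)) ^ v)) = 1 := by
    intro a
    have h := hasSum_negBinomial u a.2.1 a.2.2
    rw [← ENNReal.ofReal_tsum_of_nonneg (fun v => mul_nonneg (Nat.cast_nonneg _)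
      (moment_integrand_mem u v a).1.le) h.summable, h.tsum_eq, ENNReal.ofReal_one]
  simp_rw [this]
  simp

/-- The kernel `Q` as a Markov kernel. -/
def QKernel : Kernel ℕ ℕ :=
  ⟨fun u => weightMeasure fun v => ENNReal.ofReal (Q ν u v), measurable_of_countable _⟩

instance : IsMarkovKernel (QKernel ν) :=
  ⟨fun u => isProbabilityMeasure_weightMeasure (tsum_ofReal_Q ν u)⟩

theorem QKernel_singleton (u v : ℕ) : QKernel ν u {v} = ENNReal.ofReal (Q ν u v) :=
  weightMeasure_singleton _ v

/-- The measure `π` on the nonnegative integers. -/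
def invLaw : Measure ℕ := weightMeasure fun u => ENNReal.ofReal (invMeas ν u)

theorem invLaw_singleton (u : ℕ) : invLaw ν {u} = ENNReal.ofReal (invMeas ν u) :=
  weightMeasure_singleton _ u

theorem geom_mem {s : ℝ} (h : 0 ≤ s ∧ s ≤ 1) (u : ℕ) :
    0 ≤ s * (1 - s) ^ u ∧ s * (1 - s) ^ u ≤ 1 :=
  ⟨mul_nonneg h.1 (pow_nonneg (sub_nonneg.2 h.2) u),
    mul_le_one₀ h.2 (pow_nonneg (sub_nonneg.2 h.2) u)
      (pow_le_one₀ (sub_nonneg.2 h.2) (by linarith [h.1]))⟩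

theorem integrable_geom_S (u : ℕ) : Integrable (fun ω => S ω * (1 - S ω) ^ u) (envLaw ν) := by
  refine Integrable.of_bound (measurable_S.mul
    ((measurable_const.sub measurable_S).pow_const u)).aestronglyMeasurable 1
    (Eventually.of_forall fun ω => ?_)
  rw [Real.norm_eq_abs, abs_of_nonneg (geom_mem (S_mem ω) u).1]
  exact (geom_mem (S_mem ω) u).2

theorem ofReal_invMeas (u : ℕ) : ENNReal.ofReal (invMeas ν u) =
    ∫⁻ ω, ENNReal.ofReal (S ω * (1 - S ω) ^ u) ∂(envLaw ν) := by
  rw [invMeas, ofReal_integral_eq_lintegral_ofReal (integrable_geom_S ν u)]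
  exact Eventually.of_forall fun ω => (geom_mem (S_mem ω) u).1

variable {ν}

theorem TransientSubballistic.invMeas_pos (h : TransientSubballistic ν) (u : ℕ) :
    0 < invMeas ν u := by
  have hpos : ∀ᵐ ω ∂(envLaw ν), 0 < S ω * (1 - S ω) ^ u := by
    filter_upwards [h.ae_S] with ω hω
    exact mul_pos (rightSeries_eq hω).1 (pow_pos (sub_pos.2 (S_lt_one hω)) u)
  rw [invMeas, integral_pos_iff_support_of_nonneg
    (fun ω => (geom_mem (S_mem ω) u).1) (integrable_geom_S ν u)]
  have : envLaw ν (Function.support fun ω => S ω * (1 - S ω) ^ u) = 1 := by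
    rw [← measure_univ (μ := envLaw ν)]
    refine measure_congr ?_
    filter_upwards [hpos] with ω hω
    exact propext (iff_of_true hω.ne' trivial)
  rw [this]
  exact one_pos

theorem TransientSubballistic.tsum_invMeas (h : TransientSubballistic ν) :
    ∑' u, ENNReal.ofReal (invMeas ν u) = 1 := by
  simp_rw [ofReal_invMeas]
  have hm := measurable_S
  rw [← lintegral_tsum fun v => by fun_prop]
  have : ∀ᵐ ω ∂(envLaw ν), ∑' u : ℕ, ENNReal.ofReal (S ω * (1 - S ω) ^ u) = 1 := by
    filter_upwards [h.ae_S] with ω hω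
    have h0 := (rightSeries_eq hω).1
    have h1 := S_lt_one hω
    have hs := (hasSum_geometric_of_lt_one (r := 1 - S ω) (by linarith) (by linarith)).mul_left
      (S ω)
    rw [sub_sub_cancel, mul_inv_cancel₀ h0.ne'] at hs
    rw [← ENNReal.ofReal_tsum_of_nonneg (fun v => (geom_mem (S_mem ω) v).1) hs.summable,
      hs.tsum_eq, ENNReal.ofReal_one]
  rw [lintegral_congr_ae this]
  simp

theorem TransientSubballistic.isProbabilityMeasure_invLaw (h : TransientSubballistic ν) :
    IsProbabilityMeasure (invLaw ν) :=
  isProbabilityMeasure_weightMeasure h.tsum_invMeas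

/-- A geometric mixture of negative binomials is again geometric; the new parameter is the one found
in `rightSeries_eq`. -/
theorem hasSum_geom_negBinomial (v : ℕ) {s a : ℝ} (hs0 : 0 < s) (hs1 : s < 1) (ha0 : 0 < a)
    (ha1 : a < 1) :
    HasSum (fun u : ℕ => s * (1 - s) ^ u * (((u + v).choose v : ℝ) * (a ^ (u + 1) * (1 - a) ^ v)))
      (s * a / (1 - (1 - s) * a) * (1 - s * a / (1 - (1 - s) * a)) ^ v) := by
  have hr0 : 0 < (1 - s) * a := mul_pos (sub_pos.2 hs1) ha0
  have hr1 : (1 - s) * a < 1 := by nlinarith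
  have h := (hasSum_choose_mul_geometric_of_norm_lt_one v (r := (1 - s) * a) (by
    rw [Real.norm_eq_abs, abs_of_pos hr0]; exact hr1)).mul_left (s * a * (1 - a) ^ v)
  have hd : 1 - (1 - s) * a ≠ 0 := by linarith
  have e : s * a * (1 - a) ^ v * (1 / (1 - (1 - s) * a) ^ (v + 1)) =
      s * a / (1 - (1 - s) * a) * (1 - s * a / (1 - (1 - s) * a)) ^ v := by
    have e1 : 1 - s * a / (1 - (1 - s) * a) = (1 - a) / (1 - (1 - s) * a) := by
      rw [eq_div_iff hd, sub_mul, div_mul_cancel₀ _ hd]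
      ring
    rw [e1, div_pow, pow_succ]
    field_simp
  rw [e] at h
  refine h.congr_fun fun u => ?_
  rw [mul_pow]
  ring

/-- Fix the sites to the right of `0`: a geometric number with parameter `S`, reproduced through an
independent `ω_0`, becomes geometric with parameter `rightSeries`, and shift invariance gives this
parameter the law of `S`. -/
theorem TransientSubballistic.tsum_invMeas_mul_Q (h : TransientSubballistic ν) (v : ℕ) :
    ∑' u, ENNReal.ofReal (invMeas ν u) * ENNReal.ofReal (Q ν u v) =
      ENNReal.ofReal (invMeas ν v) := by
  have hm := measurable_S
  have hmr := measurable_rightSeries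
  have hshift : ENNReal.ofReal (invMeas ν v) =
      ∫⁻ ω, ENNReal.ofReal (rightSeries ω * (1 - rightSeries ω) ^ v) ∂(envLaw ν) := by
    rw [ofReal_invMeas]
    conv_rhs => rw [← map_reindex_envLaw ν (add_left_injective (1 : ℤ))]
    rw [lintegral_map (by fun_prop) (by fun_prop)]
    simp_rw [S_eq_rightSeries_shift]
  have hres : ENNReal.ofReal (invMeas ν v) = ∫⁻ ω, ∫⁻ a, ENNReal.ofReal
      (rightSeries (Function.update ω 0 a) * (1 - rightSeries (Function.update ω 0 a)) ^ v)
        ∂(ν : Measure (Set.Ioo (0 : ℝ) 1)) ∂(envLaw ν) := by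
    have hup : Measurable fun p : Set.Ioo (0 : ℝ) 1 × Env => Function.update p.2 (0 : ℤ) p.1 :=
      measurable_update'.comp measurable_swap
    have hF : Measurable fun ω => ENNReal.ofReal (rightSeries ω * (1 - rightSeries ω) ^ v) := by
      fun_prop
    rw [hshift]
    conv_lhs => rw [← map_update_zero_envLaw ν]
    have hG : Measurable fun p : Set.Ioo (0 : ℝ) 1 × Env => ENNReal.ofReal
        (rightSeries (Function.update p.2 0 p.1) *
          (1 - rightSeries (Function.update p.2 0 p.1)) ^ v) := hF.comp hup
    rw [lintegral_map hF hup, lintegral_prod_symm _ hG.aemeasurable]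
  rw [hres]
  have hpt : ∀ᵐ ω ∂(envLaw ν), ∫⁻ a, ENNReal.ofReal
      (rightSeries (Function.update ω 0 a) * (1 - rightSeries (Function.update ω 0 a)) ^ v)
        ∂(ν : Measure (Set.Ioo (0 : ℝ) 1)) =
      ∑' u : ℕ, ENNReal.ofReal (S ω * (1 - S ω) ^ u) * ENNReal.ofReal (Q ν u v) := by
    filter_upwards [h.ae_S] with ω hω
    have h0 := (rightSeries_eq hω).1
    have h1 := S_lt_one hω
    simp_rw [ofReal_Q]
    have e : ∀ u : ℕ, ENNReal.ofReal (S ω * (1 - S ω) ^ u) * ∫⁻ a, ENNReal.ofReal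
        (((u + v).choose v : ℝ) * ((a : ℝ) ^ (u + 1) * (1 - (a : ℝ)) ^ v))
          ∂(ν : Measure (Set.Ioo (0 : ℝ) 1)) = ∫⁻ a, ENNReal.ofReal (S ω * (1 - S ω) ^ u *
        (((u + v).choose v : ℝ) * ((a : ℝ) ^ (u + 1) * (1 - (a : ℝ)) ^ v)))
          ∂(ν : Measure (Set.Ioo (0 : ℝ) 1)) := by
      intro u
      rw [← lintegral_const_mul _ (by fun_prop)]
      simp_rw [ENNReal.ofReal_mul (geom_mem (S_mem ω) u).1]
    simp_rw [e]
    rw [← lintegral_tsum fun u => by fun_prop]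
    refine lintegral_congr fun a => ?_
    have hS : S (Function.update ω 0 a) = S ω := by
      rw [S_eq_rightSeries_shift, S_eq_rightSeries_shift]
      simp only [rightSeries, rho]
      refine congrArg _ (tsum_congr fun k => Finset.prod_congr rfl fun i _ => ?_)
      rw [Function.update_of_ne (by omega)]
    have hω' : Summable fun k => ∏ i ∈ Finset.range k,
        rho (Function.update ω 0 a) ((i : ℤ) + 1) := by
      refine hω.congr fun k => Finset.prod_congr rfl fun i _ => ?_
      rw [rho, rho, Function.update_of_ne (by omega)]
    have hr := (rightSeries_eq hω').2
    rw [hS, Function.update_self] at hr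
    have hsum := hasSum_geom_negBinomial v h0 h1 a.2.1 a.2.2
    rw [hr, ← ENNReal.ofReal_tsum_of_nonneg (fun u => mul_nonneg (geom_mem (S_mem ω) u).1
      (mul_nonneg (Nat.cast_nonneg _) (moment_integrand_mem u v a).1.le)) hsum.summable,
      hsum.tsum_eq]
  rw [lintegral_congr_ae hpt, lintegral_tsum fun u => by fun_prop]
  refine tsum_congr fun u => ?_
  rw [lintegral_mul_const _ (by fun_prop), ofReal_invMeas]

theorem TransientSubballistic.invariant (h : TransientSubballistic ν) :
    (QKernel ν).Invariant (invLaw ν) := by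
  have := h.isProbabilityMeasure_invLaw
  refine Measure.ext_of_singleton fun v => ?_
  rw [Measure.bind_apply (.singleton v) (QKernel ν).measurable.aemeasurable, lintegral_countable',
    invLaw_singleton, ← h.tsum_invMeas_mul_Q v]
  refine tsum_congr fun u => ?_
  rw [QKernel_singleton, invLaw_singleton, mul_comm]

theorem compProd_singleton [SFinite (invLaw ν)] (p : ℕ × ℕ) :
    (invLaw ν ⊗ₘ QKernel ν) {p} = ENNReal.ofReal (invMeasPair ν p.1 p.2) := by
  have hp : ({p} : Set (ℕ × ℕ)) = {p.1} ×ˢ {p.2} := by ext; simp [Prod.ext_iff]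
  rw [hp, Measure.compProd_apply_prod (.singleton _) (.singleton _), Measure.restrict_singleton,
    lintegral_smul_measure, lintegral_dirac, QKernel_singleton, invLaw_singleton, invMeasPair,
    smul_eq_mul, ENNReal.ofReal_mul]
  exact integral_nonneg fun ω => (geom_mem (S_mem ω) _).1

theorem TransientSubballistic.compProd_singleton_ne_zero (h : TransientSubballistic ν)
    [SFinite (invLaw ν)] (p : ℕ × ℕ) : (invLaw ν ⊗ₘ QKernel ν) {p} ≠ 0 := by
  rw [compProd_singleton]
  exact (ENNReal.ofReal_pos.2 (mul_pos (h.invMeas_pos _) (Q_pos ν _ _))).ne'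

end Stationary

/-! ### From the annealed walk to the stationary chain of counts. -/

section Annealed

variable {ν : ProbabilityMeasure (Set.Ioo (0 : ℝ) 1)}

/-- The factors involve distinct sites and so integrate separately. The one extra upward crossing,
due to the start at `0`, turns the multichoose coefficient into the binomial one in `Q`. -/
theorem lintegral_profileWeight (ν : ProbabilityMeasure (Set.Ioo (0 : ℝ) 1)) (n : ℕ)
    (c : ℕ → ℕ) :
    ∫⁻ ω, profileWeight (rightProb ω) (leftProb ω) n 0 c ∂(envLaw ν) =
      ∏ y ∈ Finset.range n, ENNReal.ofReal (Q ν (c (y + 1)) (c y)) := by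
  set f : ℕ → Set.Ioo (0 : ℝ) 1 → ℝ≥0∞ := fun y a => ENNReal.ofReal
    (((c (y + 1) + c y).choose (c y) : ℝ) * ((a : ℝ) ^ (c (y + 1) + 1) * (1 - (a : ℝ)) ^ c y))
    with hf
  have hfm : ∀ y, Measurable (f y) := fun y => by simp only [hf]; fun_prop
  have h1 : ∀ ω : Env, profileWeight (rightProb ω) (leftProb ω) n 0 c =
      ∏ y ∈ Finset.range n, f y (ω y) := by
    intro ω
    refine Finset.prod_congr rfl fun y _ => ?_
    have h := (ω y).2
    have h2 := sub_nonneg.2 h.2.le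
    rw [if_pos (by omega), Nat.multichoose_eq, rightProb, leftProb, hf]
    simp only
    rw [ENNReal.ofReal_mul (Nat.cast_nonneg _), ENNReal.ofReal_mul (pow_nonneg h.1.le _),
      ENNReal.ofReal_pow h.1.le, ENNReal.ofReal_pow h2, ENNReal.ofReal_natCast, mul_assoc]
    congr 3
    omega
  simp_rw [h1]
  have hind : iIndepFun (fun (y : ℕ) (ω : Env) => f y (ω y)) (envLaw ν) :=
    iIndepFun_site ν Nat.cast_injective hfm
  rw [lintegral_prod_eq_prod_lintegral_of_indepFun _ _ hind
    fun y => (hfm y).comp (measurable_pi_apply _)]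
  refine Finset.prod_congr rfl fun y _ => ?_
  rw [lintegral_site ν _ (hfm y), ofReal_Q]

theorem ae_annealedLaw {p : (ℕ → ℤ) → Prop} (hp : MeasurableSet {X | p X})
    (h : ∀ᵐ ω ∂(envLaw ν), ∀ᵐ X ∂(quenchedMeasure ω), p X) : ∀ᵐ X ∂(annealedLaw ν), p X := by
  rw [ae_iff]
  have hc : MeasurableSet {X | ¬ p X} := hp.compl
  rw [annealedLaw, Measure.bind_apply hc quenchedLaw.measurable.aemeasurable]
  refine (lintegral_congr_ae ?_).trans lintegral_zero
  filter_upwards [h] with ω hω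
  exact ae_iff.1 hω

theorem ae_annealedLaw_start : ∀ᵐ X ∂(annealedLaw ν), X 0 = 0 :=
  ae_annealedLaw ((measurable_pi_apply 0 : Measurable fun X : ℕ → ℤ => X 0) (.singleton 0))
    (Eventually.of_forall ae_start)

theorem ae_annealedLaw_step : ∀ᵐ X ∂(annealedLaw ν), ∀ t, X (t + 1) ≤ X t + 1 := by
  rw [ae_all_iff]
  intro t
  refine ae_annealedLaw (measurableSet_le (measurable_pi_apply (t + 1))
    ((measurable_pi_apply t).add_const 1)) (Eventually.of_forall fun ω => ?_)
  filter_upwards [ae_step_le ω] with X hX using hX t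

theorem TransientSubballistic.ae_annealedLaw_hit (h : TransientSubballistic ν) (n : ℕ) :
    ∀ᵐ X ∂(annealedLaw ν), ∃ t, X t = (n : ℤ) := by
  refine ae_annealedLaw ?_ ?_
  · have : {X : ℕ → ℤ | ∃ t, X t = (n : ℤ)} = ⋃ t, (fun X : ℕ → ℤ => X t) ⁻¹' {(n : ℤ)} := by
      ext; simp
    rw [this]
    exact MeasurableSet.iUnion fun t => measurable_pi_apply t (.singleton _)
  · filter_upwards [h.ae_tendsto_left] with ω hω using ae_exists_hit hω n

theorem annealedLaw_firstVisitProfile_le (n : ℕ) (c : ℕ → ℕ) :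
    annealedLaw ν (⋃ t, firstVisitProfile n c t) ≤
      ∏ y ∈ Finset.range n, ENNReal.ofReal (Q ν (c (y + 1)) (c y)) := by
  rw [annealedLaw, Measure.bind_apply (MeasurableSet.iUnion fun t =>
    measurableSet_firstVisitProfile n c t) quenchedLaw.measurable.aemeasurable,
    ← lintegral_profileWeight]
  exact lintegral_mono fun ω => quenchedMeasure_firstVisitProfile_le ω n c

/-- The sequence with entries `y 0, …, y n`, continued by `0`. -/
def extendZero {n : ℕ} (y : Fin (n + 1) → ℕ) (i : ℕ) : ℕ :=
  if h : i < n + 1 then y ⟨i, h⟩ else 0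

theorem extendZero_apply {n : ℕ} (c : ℕ → ℕ) {i : ℕ} (hi : i ≤ n) :
    extendZero (fun j : Fin (n + 1) => c j) i = c i := by
  rw [extendZero, dif_pos (by omega)]

/-- Read from site `n` down to site `0`, the counts are a path of the chain started at `c n = 0`;
the factor `π(0)` makes that start stationary. -/
theorem TransientSubballistic.mul_prod_Q (h : TransientSubballistic ν) (n : ℕ) {c : ℕ → ℕ}
    (hc : c n = 0) :
    invLaw ν {0} * ∏ y ∈ Finset.range n, ENNReal.ofReal (Q ν (c (y + 1)) (c y)) =
      chainLaw (invLaw ν) (QKernel ν) n {z | ∀ k ≤ n, z k = c (n - k)} := by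
  have := h.isProbabilityMeasure_invLaw
  rw [chainLaw_cylinder (fun k => c (n - k)), Nat.sub_zero, hc, ← Finset.prod_range_reflect]
  congr 1
  refine Finset.prod_congr rfl fun k hk => ?_
  have hk' := Finset.mem_range.1 hk
  rw [QKernel_singleton]
  congr 3 <;> omega

theorem pathSum_reflect (g : ℕ × ℕ → ℝ) {n : ℕ} {c z : ℕ → ℕ} (hz : ∀ k ≤ n, z k = c (n - k)) :
    pathSum g n z = ∑ y ∈ Finset.range n, g (c (y + 1), c y) := by
  unfold pathSum
  rw [← Finset.sum_range_reflect]
  refine Finset.sum_congr rfl fun k hk => ?_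
  have hk' := Finset.mem_range.1 hk
  rw [hz _ (by omega), hz _ (by omega)]
  congr 3 <;> omega

/-- Transfer from the walk to the stationary chain of left-step counts. -/
theorem TransientSubballistic.annealedLaw_sum_nonneg_le (h : TransientSubballistic ν) (n : ℕ)
    (g : ℕ × ℕ → ℝ) :
    annealedLaw ν {X | 0 ≤ ∑ x ∈ Finset.range n, g (leftSteps X n (x + 1), leftSteps X n x)} ≤
      (invLaw ν {0})⁻¹ * chainLaw (invLaw ν) (QKernel ν) n {z | 0 ≤ pathSum g n z} := by
  have := h.isProbabilityMeasure_invLaw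
  have hπ0 : invLaw ν {0} ≠ 0 := by
    rw [invLaw_singleton]
    exact (ENNReal.ofReal_pos.2 (h.invMeas_pos 0)).ne'
  set C : Set (Fin (n + 1) → ℕ) := {y | extendZero y n = 0 ∧
    0 ≤ ∑ x ∈ Finset.range n, g (extendZero y (x + 1), extendZero y x)} with hC
  have hsub : annealedLaw ν
      {X | 0 ≤ ∑ x ∈ Finset.range n, g (leftSteps X n (x + 1), leftSteps X n x)} ≤
      annealedLaw ν (⋃ y : C, ⋃ t, firstVisitProfile n (extendZero y.1) t) := by
    refine measure_mono_ae ?_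
    filter_upwards [ae_annealedLaw_start, ae_annealedLaw_step, h.ae_annealedLaw_hit n]
      with X h0 hstep hit hX
    have hX' : 0 ≤ ∑ x ∈ Finset.range n, g (leftSteps X n (x + 1), leftSteps X n x) := hX
    have hext : ∀ x ≤ n, extendZero (fun j : Fin (n + 1) => leftSteps X n j) x =
      leftSteps X n x := fun x hx => extendZero_apply (leftSteps X n) hx
    refine Set.mem_iUnion.2 ⟨⟨fun j => leftSteps X n j, ?_, ?_⟩, Set.mem_iUnion.2
      ⟨hittingTime X n, mem_firstVisitProfile h0 hstep hit fun x hx => (hext x hx).symm⟩⟩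
    · rw [hext n le_rfl, leftSteps_self]
    · refine hX'.trans_eq (Finset.sum_congr rfl fun x hx => ?_)
      have := Finset.mem_range.1 hx
      rw [hext _ (by omega), hext _ (by omega)]
  have hmeas : ∀ c : ℕ → ℕ, MeasurableSet {z : ℕ → ℕ | ∀ k ≤ n, z k = c (n - k)} := by
    intro c
    have : {z : ℕ → ℕ | ∀ k ≤ n, z k = c (n - k)} =
        ⋂ k ∈ Set.Iic n, (fun z => z k) ⁻¹' {c (n - k)} := by
      ext; simp
    rw [this]
    exact MeasurableSet.biInter (Set.to_countable _) fun k _ => measurable_pi_apply k (.singleton _)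
  have hdisj : Pairwise (Function.onFun Disjoint fun y : C =>
      {z : ℕ → ℕ | ∀ k ≤ n, z k = extendZero y.1 (n - k)}) := by
    intro y y' hne
    refine Set.disjoint_left.2 fun z hz hz' => hne (Subtype.ext (funext fun j => ?_))
    have hj : (j : ℕ) ≤ n := Nat.lt_succ_iff.1 j.2
    have h1 := hz (n - j) (Nat.sub_le _ _)
    have h2 := hz' (n - j) (Nat.sub_le _ _)
    rw [h1, Nat.sub_sub_self hj] at h2
    simpa [extendZero, hj] using h2
  rw [← ENNReal.div_eq_inv_mul, ENNReal.le_div_iff_mul_le (Or.inl hπ0)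
    (Or.inl (measure_ne_top _ _)), mul_comm]
  -- A union bound over count vectors on the side of the walk meets exact additivity over disjoint
  -- cylinders on the side of the chain, so nothing is lost in summing.
  calc invLaw ν {0} * annealedLaw ν
        {X | 0 ≤ ∑ x ∈ Finset.range n, g (leftSteps X n (x + 1), leftSteps X n x)}
      ≤ invLaw ν {0} * ∑' y : C, annealedLaw ν (⋃ t, firstVisitProfile n (extendZero y.1) t) := by
        gcongr
        exact hsub.trans (measure_iUnion_le _)
    _ ≤ ∑' y : C, chainLaw (invLaw ν) (QKernel ν) n
          {z | ∀ k ≤ n, z k = extendZero y.1 (n - k)} := by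
        rw [← ENNReal.tsum_mul_left]
        refine ENNReal.tsum_le_tsum fun y => ?_
        rw [← h.mul_prod_Q n y.2.1]
        gcongr
        exact annealedLaw_firstVisitProfile_le n _
    _ = chainLaw (invLaw ν) (QKernel ν) n
          (⋃ y : C, {z | ∀ k ≤ n, z k = extendZero y.1 (n - k)}) :=
        (measure_iUnion hdisj fun y => hmeas _).symm
    _ ≤ chainLaw (invLaw ν) (QKernel ν) n {z | 0 ≤ pathSum g n z} := by
        refine measure_mono (Set.iUnion_subset fun y z hz => ?_)
        change 0 ≤ pathSum g n z
        rw [pathSum_reflect g hz]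
        exact y.2.2

theorem TransientSubballistic.tendsto_annealedLaw_sum_nonneg (h : TransientSubballistic ν)
    [IsProbabilityMeasure (invLaw ν)] {g : ℕ × ℕ → ℝ}
    (hg : Integrable g (invLaw ν ⊗ₘ QKernel ν)) (hneg : ∫ p, g p ∂(invLaw ν ⊗ₘ QKernel ν) < 0) :
    Tendsto (fun n => annealedLaw ν
      {X | 0 ≤ ∑ x ∈ Finset.range n, g (leftSteps X n (x + 1), leftSteps X n x)})
      atTop (𝓝 0) := by
  have h1 := tendsto_chainLaw_pathSum_nonneg h.invariant h.compProd_singleton_ne_zero hg hneg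
  have hπ0 : invLaw ν {0} ≠ 0 := by
    rw [invLaw_singleton]
    exact (ENNReal.ofReal_pos.2 (h.invMeas_pos 0)).ne'
  have h2 := ENNReal.Tendsto.const_mul (a := (invLaw ν {0})⁻¹) h1
    (Or.inr (ENNReal.inv_ne_top.2 hπ0))
  rw [mul_zero] at h2
  exact tendsto_of_tendsto_of_tendsto_of_le_of_le tendsto_const_nhds h2 (fun _ => zero_le)
    fun n => h.annealedLaw_sum_nonneg_le n g

end Annealed

/-! ### Moments determine the site law; positivity of the relative entropy. -/

section Identifiability

open BoundedContinuousFunction in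
-- Polynomials in `1 - a` form a point-separating star-subalgebra of bounded continuous functions on
-- a Polish space, hence determine finite measures.
theorem ext_of_moments {μ μ' : Measure (Set.Ioo (0 : ℝ) 1)} [IsFiniteMeasure μ]
    [IsFiniteMeasure μ']
    (h : ∀ v : ℕ, ∫ a, (1 - (a : ℝ)) ^ v ∂μ = ∫ a, (1 - (a : ℝ)) ^ v ∂μ') : μ = μ' := by
  let f : Set.Ioo (0 : ℝ) 1 →ᵇ ℝ := BoundedContinuousFunction.ofNormedAddCommGroup
    (fun a => 1 - (a : ℝ)) (by fun_prop) 1 fun a => by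
      have := a.2
      rw [Real.norm_eq_abs, abs_of_pos (by linarith [this.2])]
      linarith [this.1]
  have hf : ∀ a, f a = 1 - (a : ℝ) := fun a => rfl
  let A : StarSubalgebra ℝ (Set.Ioo (0 : ℝ) 1 →ᵇ ℝ) :=
    { Algebra.adjoin ℝ {f} with
      star_mem' := fun {g} hg => by
        have : star g = g := by ext; simp
        rwa [this] }
  have hpolish : PolishSpace (Set.Ioo (0 : ℝ) 1) := isOpen_Ioo.polishSpace
  refine ext_of_forall_mem_subalgebra_integral_eq_of_polish (𝕜 := ℝ) (A := A) ?_ ?_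
  · intro a b hab
    refine ⟨f, ⟨toContinuousMapStarₐ ℝ f, ⟨f, ?_, rfl⟩, rfl⟩, fun hne => hab (Subtype.ext ?_)⟩
    · exact Algebra.subset_adjoin rfl
    · rw [hf, hf] at hne
      linarith
  · intro g hg
    have hg' : g ∈ Algebra.adjoin ℝ {f} := hg
    rw [Algebra.adjoin_singleton_eq_range_aeval] at hg'
    obtain ⟨P, rfl⟩ := hg'
    have hP : ∀ a, (Polynomial.aeval f P) a =
        ∑ i ∈ Finset.range (P.natDegree + 1), P.coeff i * (1 - (a : ℝ)) ^ i := by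
      intro a
      rw [Polynomial.aeval_eq_sum_range]
      simp [hf, BoundedContinuousFunction.sum_apply]
    have hint : ∀ (μ : Measure (Set.Ioo (0 : ℝ) 1)) [IsFiniteMeasure μ] (i : ℕ),
        Integrable (fun a : Set.Ioo (0 : ℝ) 1 => P.coeff i * (1 - (a : ℝ)) ^ i) μ := by
      intro μ _ i
      refine Integrable.const_mul (Integrable.of_bound (by fun_prop) 1
        (Eventually.of_forall fun a => ?_)) _
      have := a.2
      rw [Real.norm_eq_abs, abs_of_nonneg (pow_nonneg (by linarith [this.2]) _)]
      exact pow_le_one₀ (by linarith [this.2]) (by linarith [this.1])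
    have key : ∀ (μ : Measure (Set.Ioo (0 : ℝ) 1)) [IsFiniteMeasure μ],
        ∫ a, (Polynomial.aeval f P) a ∂μ =
        ∑ i ∈ Finset.range (P.natDegree + 1), P.coeff i * ∫ a, (1 - (a : ℝ)) ^ i ∂μ := by
      intro μ _
      simp_rw [hP]
      rw [integral_finsetSum _ fun i _ => hint μ i]
      simp_rw [integral_const_mul]
    exact (key μ).trans (((Finset.sum_congr rfl fun i _ => by rw [h i])).trans (key μ').symm)

/-- These are the moments of `1 - a` under `a ν(da)`, and the density `a > 0` can be divided out
again. -/
theorem eq_of_moment_eq {ν ν' : ProbabilityMeasure (Set.Ioo (0 : ℝ) 1)}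
    (h : ∀ v, moment ν 0 v = moment ν' 0 v) : ν = ν' := by
  set w : Set.Ioo (0 : ℝ) 1 → ℝ≥0∞ := fun a => ENNReal.ofReal (a : ℝ) with hw
  have hwm : Measurable w := by simp only [hw]; fun_prop
  have hfin : ∀ ν : ProbabilityMeasure (Set.Ioo (0 : ℝ) 1),
      IsFiniteMeasure ((ν : Measure (Set.Ioo (0 : ℝ) 1)).withDensity w) := by
    intro ν
    refine isFiniteMeasure_withDensity (ne_top_of_le_ne_top ENNReal.one_ne_top ?_)
    calc ∫⁻ a, w a ∂(ν : Measure (Set.Ioo (0 : ℝ) 1))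
        ≤ ∫⁻ _, 1 ∂(ν : Measure (Set.Ioo (0 : ℝ) 1)) :=
          lintegral_mono fun a => ENNReal.ofReal_le_one.2 a.2.2.le
      _ = 1 := by simp
  have hfin1 := hfin ν
  have hfin2 := hfin ν'
  have key : ∀ (ν : ProbabilityMeasure (Set.Ioo (0 : ℝ) 1)) (v : ℕ),
      ∫ a, (1 - (a : ℝ)) ^ v ∂((ν : Measure (Set.Ioo (0 : ℝ) 1)).withDensity w) =
        moment ν 0 v := by
    intro ν v
    rw [integral_withDensity_eq_integral_toReal_smul hwm
      (Eventually.of_forall fun a => ENNReal.ofReal_lt_top)]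
    refine integral_congr_ae (Eventually.of_forall fun a => ?_)
    simp [hw, ENNReal.toReal_ofReal a.2.1.le]
  have heq : (ν : Measure (Set.Ioo (0 : ℝ) 1)).withDensity w =
      (ν' : Measure (Set.Ioo (0 : ℝ) 1)).withDensity w :=
    ext_of_moments fun v => by rw [key, key, h]
  have hinv : ∀ ν : ProbabilityMeasure (Set.Ioo (0 : ℝ) 1),
      ((ν : Measure (Set.Ioo (0 : ℝ) 1)).withDensity w).withDensity (fun a => (w a)⁻¹) =
        (ν : Measure (Set.Ioo (0 : ℝ) 1)) := fun ν =>
    withDensity_inv_same hwm (Eventually.of_forall fun a => (ENNReal.ofReal_pos.2 a.2.1).ne')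
      (Eventually.of_forall fun a => ENNReal.ofReal_ne_top)
  refine Subtype.ext ?_
  change (ν : Measure (Set.Ioo (0 : ℝ) 1)) = (ν' : Measure (Set.Ioo (0 : ℝ) 1))
  rw [← hinv ν, heq, hinv]

variable {ν ν' : ProbabilityMeasure (Set.Ioo (0 : ℝ) 1)}

theorem lintegral_Q_ratio [IsProbabilityMeasure (invLaw ν)] :
    ∫⁻ p, ENNReal.ofReal (Q ν' p.1 p.2 / Q ν p.1 p.2) ∂(invLaw ν ⊗ₘ QKernel ν) = 1 := by
  have hm : Measurable fun p : ℕ × ℕ => ENNReal.ofReal (Q ν' p.1 p.2 / Q ν p.1 p.2) :=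
    measurable_of_countable _
  rw [Measure.lintegral_compProd hm]
  have : ∀ u : ℕ, ∫⁻ v, ENNReal.ofReal (Q ν' u v / Q ν u v) ∂(QKernel ν u) = 1 := by
    intro u
    rw [lintegral_countable', ← tsum_ofReal_Q ν' u]
    refine tsum_congr fun v => ?_
    rw [QKernel_singleton, ← ENNReal.ofReal_mul (div_pos (Q_pos ν' u v) (Q_pos ν u v)).le,
      div_mul_cancel₀ _ (Q_pos ν u v).ne']
  simp_rw [this]
  simp

theorem phi_sub_phi (u v : ℕ) :
    phi ν' u v - phi ν u v = Real.log (Q ν' u v / Q ν u v) := by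
  have hc : ((u + v).choose v : ℝ) ≠ 0 := by
    exact_mod_cast (Nat.choose_pos (Nat.le_add_left v u)).ne'
  rw [Q, Q, mul_div_mul_left _ _ hc, Real.log_div (moment_pos ν' u v).ne' (moment_pos ν u v).ne']
  rfl

/-- Strict positivity of the relative entropy. -/
theorem TransientSubballistic.integral_phi_sub_neg (h : TransientSubballistic ν)
    [IsProbabilityMeasure (invLaw ν)] (hne : ν' ≠ ν)
    (hint : Integrable (fun p : ℕ × ℕ => phi ν' p.1 p.2 - phi ν p.1 p.2)
      (invLaw ν ⊗ₘ QKernel ν)) :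
    ∫ p, (phi ν' p.1 p.2 - phi ν p.1 p.2) ∂(invLaw ν ⊗ₘ QKernel ν) < 0 := by
  set r : ℕ × ℕ → ℝ := fun p => Q ν' p.1 p.2 / Q ν p.1 p.2 with hr
  have hr0 : ∀ p, 0 < r p := fun p => div_pos (Q_pos ν' _ _) (Q_pos ν _ _)
  have hri : Integrable r (invLaw ν ⊗ₘ QKernel ν) :=
    ⟨(measurable_of_countable r).aestronglyMeasurable, by
      rw [hasFiniteIntegral_iff_ofReal (Eventually.of_forall fun p => (hr0 p).le),
        lintegral_Q_ratio]
      exact ENNReal.one_lt_top⟩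
  have hr1 : ∫ p, r p ∂(invLaw ν ⊗ₘ QKernel ν) = 1 := by
    rw [integral_eq_lintegral_of_nonneg_ae (Eventually.of_forall fun p => (hr0 p).le)
      hri.aestronglyMeasurable, lintegral_Q_ratio, ENNReal.toReal_one]
  -- The defect in `log x ≤ x - 1` at the likelihood ratio. As the ratio has mean one, the mean of
  -- `d` is exactly the relative entropy.
  set d : ℕ × ℕ → ℝ := fun p => (r p - 1) - (phi ν' p.1 p.2 - phi ν p.1 p.2) with hd
  have hd0 : ∀ p, 0 ≤ d p := fun p => by
    have := Real.log_le_sub_one_of_pos (hr0 p)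
    simp only [hd, phi_sub_phi]
    linarith
  have hri1 : Integrable (fun p => r p - 1) (invLaw ν ⊗ₘ QKernel ν) :=
    hri.sub (integrable_const 1)
  have hdi : Integrable d (invLaw ν ⊗ₘ QKernel ν) := hri1.sub hint
  have hdint : ∫ p, d p ∂(invLaw ν ⊗ₘ QKernel ν) =
      - ∫ p, (phi ν' p.1 p.2 - phi ν p.1 p.2) ∂(invLaw ν ⊗ₘ QKernel ν) := by
    rw [integral_sub hri1 hint, integral_sub hri (integrable_const 1), hr1]
    simp
  have hnonneg : 0 ≤ ∫ p, d p ∂(invLaw ν ⊗ₘ QKernel ν) := integral_nonneg hd0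
  -- Zero entropy makes `d` vanish at every pair, all pairs being charged; the equality case of the
  -- logarithm inequality at `(0, v)` then equates the moments.
  refine lt_of_le_of_ne (by linarith) fun h0 => hne ?_
  rw [h0, neg_zero, integral_eq_zero_iff_of_nonneg hd0 hdi] at hdint
  have hd' := forall_of_ae_of_singleton h.compProd_singleton_ne_zero hdint
  refine eq_of_moment_eq fun v => ?_
  have h1 : d (0, v) = 0 := hd' (0, v)
  have h2 : r (0, v) = 1 := by
    by_contra hne1
    have := Real.log_lt_sub_one_of_pos (hr0 (0, v)) hne1
    simp only [hd, phi_sub_phi] at h1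
    linarith
  have h3 := (div_eq_one_iff_eq (Q_pos ν 0 v).ne').1 h2
  simpa [Q] using h3

end Identifiability

/-! ### Domination near a wrong parameter. -/

section Consistency

/-- The bracketing step of Wald's consistency argument: near a parameter at which the limiting
criterion is negative, the criteria are dominated by one function of negative mean. -/
theorem exists_dominating_neg {β P : Type*} [MeasurableSpace β] [Countable β]
    [MeasurableSingletonClass β] [PseudoMetricSpace P] {μ : Measure β} {f : P → β → ℝ}
    {G : β → ℝ} (hG : Integrable G μ) (hfG : ∀ θ p, |f θ p| ≤ G p)
    (hcont : ∀ p, Continuous fun θ => f θ p) {θ : P} (hneg : ∫ p, f θ p ∂μ < 0) :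
    ∃ r > 0, ∃ g : β → ℝ, Integrable g μ ∧ ∫ p, g p ∂μ < 0 ∧
      ∀ θ', dist θ' θ < r → ∀ p, f θ' p ≤ g p := by
  have hpos : ∀ k : ℕ, (0 : ℝ) < 1 / ((k : ℝ) + 1) := fun k => Nat.one_div_pos_of_nat
  -- Suprema over shrinking balls converge pointwise to `f θ` by continuity, so dominated
  -- convergence makes some mean negative. Measurability of the supremum is free on a countable
  -- space.
  set g : ℕ → β → ℝ := fun k p => ⨆ θ' : Metric.ball θ (1 / ((k : ℝ) + 1)), f θ' p with hg
  have hbdd : ∀ k p, BddAbove (Set.range fun θ' : Metric.ball θ (1 / ((k : ℝ) + 1)) => f θ' p) :=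
    fun k p => ⟨G p, by rintro _ ⟨θ', rfl⟩; exact (le_abs_self _).trans (hfG θ' p)⟩
  have hle : ∀ (k : ℕ) p θ', dist θ' θ < 1 / ((k : ℝ) + 1) → f θ' p ≤ g k p := fun k p θ' h =>
    le_ciSup (hbdd k p) (⟨θ', h⟩ : Metric.ball θ (1 / ((k : ℝ) + 1)))
  have hself : ∀ k p, f θ p ≤ g k p := fun k p => hle k p θ (by simpa using hpos k)
  have hne : ∀ k : ℕ, Nonempty (Metric.ball θ (1 / ((k : ℝ) + 1))) := fun k =>
    ⟨⟨θ, Metric.mem_ball_self (hpos k)⟩⟩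
  have hgG : ∀ k p, |g k p| ≤ G p := fun k p => by
    have := hne k
    exact abs_le.2 ⟨(abs_le.1 (hfG θ p)).1.trans (hself k p),
      ciSup_le fun θ' => (le_abs_self _).trans (hfG θ' p)⟩
  have hlim : ∀ p, Tendsto (fun k => g k p) atTop (𝓝 (f θ p)) := by
    intro p
    rw [Metric.tendsto_atTop]
    intro η hη
    obtain ⟨δ, hδ, hδf⟩ := Metric.continuous_iff.1 (hcont p) θ (η / 2) (half_pos hη)
    obtain ⟨N, hN⟩ := exists_nat_one_div_lt hδ
    refine ⟨N, fun k hk => ?_⟩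
    have hk' : 1 / ((k : ℝ) + 1) ≤ 1 / ((N : ℝ) + 1) := Nat.one_div_le_one_div hk
    have := hne k
    have h1 : g k p ≤ f θ p + η / 2 := ciSup_le fun θ' => by
      have h2 : dist (θ' : P) θ < 1 / ((k : ℝ) + 1) := θ'.2
      have h3 := hδf θ' (by linarith)
      rw [Real.dist_eq] at h3
      linarith [(abs_lt.1 h3).2]
    rw [Real.dist_eq, abs_of_nonneg (sub_nonneg.2 (hself k p))]
    linarith
  have hint := tendsto_integral_of_dominated_convergence (μ := μ) G
    (fun k => (measurable_of_countable (g k)).aestronglyMeasurable) hG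
    (fun k => Eventually.of_forall fun p => hgG k p) (Eventually.of_forall hlim)
  obtain ⟨k, hk⟩ := (hint.eventually (gt_mem_nhds hneg)).exists
  exact ⟨_, hpos k, g k, hG.mono' (measurable_of_countable (g k)).aestronglyMeasurable
    (Eventually.of_forall fun p => hgG k p), hk, fun θ' h p => hle k p θ' h⟩

end Consistency

end RWRE

end


/-! ### Consistency by compactness. -/

theorem theorem1 {d : ℕ} (Θ : Set (EuclideanSpace ℝ (Fin d))) (hΘ : IsCompact Θ)
    (ν : Θ → ProbabilityMeasure (Set.Ioo (0 : ℝ) 1))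
    -- the true parameter, an interior point, and the reference parameter of the criterion
    (θstar : Θ) (hθstar : (θstar : EuclideanSpace ℝ (Fin d)) ∈ interior Θ) (θ₀ : Θ)
    -- transience and sub-ballisticity for every parameter
    (hsub : ∀ θ : Θ, RWRE.TransientSubballistic (ν θ))
    -- continuity
    (hcont : ∀ u v : ℕ, Continuous fun θ : Θ => RWRE.phi (ν θ) u v)
    -- identifiability
    (hident : ∀ θ θ' : Θ, ν θ ≠ ν θ' ↔ θ ≠ θ')
    -- uniform integrability
    (hunif : ∀ θ : Θ,
      (∑' p : ℕ × ℕ, ENNReal.ofReal (RWRE.invMeasPair (ν θ) p.1 p.2) *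
        (⨆ θ' : Θ, ENNReal.ofReal |RWRE.phi (ν θ') p.1 p.2 - RWRE.phi (ν θ₀) p.1 p.2|)) < ∞)
    -- a measurable choice of maximizers of the criterion, on the event that `n` is reached
    (θhat : ℕ → (ℕ → ℤ) → Θ) (hmeas : ∀ n, Measurable (θhat n))
    (hmax : ∀ n : ℕ, ∀ᵐ X ∂(RWRE.annealedLaw (ν θstar)), (∃ t, X t = (n : ℤ)) →
      ∀ θ : Θ, RWRE.criterion ν θ₀ n X θ ≤ RWRE.criterion ν θ₀ n X (θhat n X)) :
    TendstoInMeasure (RWRE.annealedLaw (ν θstar)) θhat atTop (fun _ => θstar) := by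
  have hT := hsub θstar
  have hprob := hT.isProbabilityMeasure_invLaw
  set μ := RWRE.invLaw (ν θstar) ⊗ₘ RWRE.QKernel (ν θstar) with hμ
  set G : ℕ × ℕ → ℝ≥0∞ := fun p =>
    ⨆ θ' : Θ, ENNReal.ofReal |RWRE.phi (ν θ') p.1 p.2 - RWRE.phi (ν θ₀) p.1 p.2| with hG
  have hGm : Measurable G := measurable_of_countable G
  have hGint : ∫⁻ p, G p ∂μ ≠ ∞ := by
    rw [lintegral_countable']
    refine ((tsum_congr fun p => ?_).trans_lt (hunif θstar)).ne
    rw [hμ, RWRE.compProd_singleton, mul_comm]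
  -- Integrability gives finiteness almost everywhere, hence everywhere because each pair has
  -- positive mass; `toReal` therefore loses nothing.
  have hGtop : ∀ p, G p ≠ ∞ := fun p => (RWRE.forall_of_ae_of_singleton
    hT.compProd_singleton_ne_zero (ae_lt_top hGm hGint) p).ne
  have hGi : Integrable (fun p => (G p).toReal) μ :=
    integrable_toReal_of_lintegral_ne_top hGm.aemeasurable hGint
  have hphi : ∀ (θ : Θ) (p : ℕ × ℕ),
      |RWRE.phi (ν θ) p.1 p.2 - RWRE.phi (ν θ₀) p.1 p.2| ≤ (G p).toReal := fun θ p =>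
    (ENNReal.ofReal_le_iff_le_toReal (hGtop p)).1
      (le_iSup (fun θ' : Θ => ENNReal.ofReal
        |RWRE.phi (ν θ') p.1 p.2 - RWRE.phi (ν θ₀) p.1 p.2|) θ)
  -- Recentring at the true parameter removes the reference parameter, turns the mean into minus a
  -- relative entropy, and at most doubles the envelope.
  set f : Θ → ℕ × ℕ → ℝ := fun θ p => RWRE.phi (ν θ) p.1 p.2 - RWRE.phi (ν θstar) p.1 p.2 with hf
  have hfG : ∀ θ p, |f θ p| ≤ 2 * (G p).toReal := by
    intro θ p
    have h1 := abs_le.1 (hphi θ p)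
    have h2 := abs_le.1 (hphi θstar p)
    exact abs_le.2 ⟨by simp only [hf]; linarith, by simp only [hf]; linarith⟩
  have hfi : ∀ θ, Integrable (f θ) μ := fun θ => (hGi.const_mul 2).mono'
    (measurable_of_countable _).aestronglyMeasurable (Eventually.of_forall fun p => hfG θ p)
  have hdom : ∀ θ : Θ, θ ≠ θstar → ∃ r > 0, ∃ g : ℕ × ℕ → ℝ, Integrable g μ ∧ ∫ p, g p ∂μ < 0 ∧
      ∀ θ', dist θ' θ < r → ∀ p, f θ' p ≤ g p := fun θ hne =>
    RWRE.exists_dominating_neg (hGi.const_mul 2) hfG (fun p => (hcont p.1 p.2).sub continuous_const)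
      (hT.integral_phi_sub_neg ((hident θ θstar).2 hne) (hfi θ))
  rw [tendstoInMeasure_iff_dist]
  intro ε hε
  have hcompact : CompactSpace Θ := isCompact_iff_compactSpace.1 hΘ
  have hK : IsCompact {θ : Θ | ε ≤ dist θ θstar} :=
    (isClosed_le continuous_const (continuous_id.dist continuous_const)).isCompact
  have hKne : ∀ θ ∈ {θ : Θ | ε ≤ dist θ θstar}, θ ≠ θstar := by
    rintro θ hθ rfl
    have h : ε ≤ dist θ θ := hθ
    rw [dist_self] at h
    linarith
  choose! r hr g hgi hgneg hgle using hdom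
  obtain ⟨t, htK, hcover⟩ := hK.elim_nhds_subcover (fun θ => Metric.ball θ (r θ))
    fun θ hθ => Metric.ball_mem_nhds θ (hr θ (hKne θ hθ))
  -- A far maximizer lies in one of the covering balls. It does at least as well as the true
  -- parameter, so the sum of the function dominating on that ball is nonnegative.
  have hbound : ∀ n, RWRE.annealedLaw (ν θstar) {X | ε ≤ dist (θhat n X) θstar} ≤
      ∑ θ ∈ t, RWRE.annealedLaw (ν θstar) {X | 0 ≤ ∑ x ∈ Finset.range n,
        g θ (RWRE.leftSteps X n (x + 1), RWRE.leftSteps X n x)} := by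
    intro n
    refine le_trans (measure_mono_ae ?_) (measure_biUnion_finset_le t _)
    filter_upwards [hmax n, hT.ae_annealedLaw_hit n] with X hX hit hfar
    obtain ⟨θ, hθt, hθ⟩ := Set.mem_iUnion₂.1 (hcover (show θhat n X ∈ _ from hfar))
    refine Set.mem_iUnion₂.2 ⟨θ, hθt, ?_⟩
    have h1 := sub_nonneg.2 (hX hit θstar)
    rw [RWRE.criterion, RWRE.criterion, ← Finset.sum_sub_distrib] at h1
    refine h1.trans (Finset.sum_le_sum fun x _ => ?_)
    have h2 := hgle θ (hKne θ (htK θ hθt)) (θhat n X) hθ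
      (RWRE.leftSteps X n (x + 1), RWRE.leftSteps X n x)
    simp only [hf] at h2
    linarith
  refine tendsto_of_tendsto_of_tendsto_of_le_of_le tendsto_const_nhds ?_ (fun _ => zero_le) hbound
  have hzero := tendsto_finsetSum t fun θ hθ => hT.tendsto_annealedLaw_sum_nonneg
    (hgi θ (hKne θ (htK θ hθ))) (hgneg θ (hKne θ (htK θ hθ)))
  rwa [Finset.sum_const_zero] at hzero
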